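/- Conventions. Manifolds are smooth, Hausdorff, second countable, finite-dimensional and without boundary; vector bundles are smooth, real and of finite rank; $\Gamma V$ is the $C^\infty(M)$-module of smooth sections of a vector bundle $V\to M$. A *Lie algebroid* on $M$ is a vector bundle $A\to M$ with a vector bundle map $a\colon A\to TM$ over $\mathrm{id}_M$ (the anchor) and an $\mathbb R$-bilinear alternating bracket on $\Gamma A$ that satisfies the Jacobi identity, $a([X,Y])=[a(X),a(Y)]$ and $[X,fY]=f[X,Y]+a(X)(f)\,Y$ for $X,Y\in\Gamma A$, $f\in C^\infty(M)$. For a vector bundle $E\to F$, let $\mathfrak D(E)$ be the Lie algebroid on $F$ whose smooth sections are the derivative endomorphisms of $\Gamma E$: the $\mathbb R$-linear maps $D\colon\Gamma E\to\Gamma E$ together with a vector field $D_F$ on $F$ (determined by $D$ if $E$ has positive rank) such that $D(h\psi)=hD(\psi)+D_F(h)\psi$ for $h\in C^\infty(F)$, $\psi\in\Gamma E$. Its bracket is the commutator (on the operators and on the vector fields) and its anchor is $D\mapsto D_F$. A *representation* of a Lie algebroid $B$ on $F$ on the vector bundle $E\to F$ is a Lie algebroid morphism $\sigma\colon B\to\mathfrak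 D(E)$ over $\mathrm{id}_F$, i.e. a vector bundle map that commutes with the anchors and preserves the brackets of sections. Let $A$ be a Lie algebroid on $M$ with anchor $a$, let $\varphi\colon F\to M$ be a fibered manifold (a surjective submersion), and let $X\mapsto X_F$, $\Gamma A\to\Gamma TF$, be an infinitesimal action of $A$ on $F$: an $\mathbb R$-linear, bracket-preserving map such that $X_F$ is $\varphi$-projectable to $a(X)$ and $(fX)_F=(f\circ\varphi)X_F$ for $f\in C^\infty(M)$. Let $E$ be a vector bundle over $F$. A *derivative representation* of $A$ on $E$ associated to the action is a morphism of Lie algebras $\rho\colon\Gamma A\to\Gamma\mathfrak D(E)$ with $(\rho(X))_F=X_F$ and $\rho(fX)=(f\circ\varphi)\rho(X)$ for all $X\in\Gamma A$, $f\in C^\infty(M)$. For $h\in C^\infty(F)$ and $X\in\Gamma A$ write $h\otimes X$ for the section $h\,(X\circ\varphi)$ of the pullback bundle $\varphi^*A$. **Theorem 3.2.** There is exactly one Lie algebroid structure on $\varphi^*A$ (the action Lie algebroid $A\ltimes F$) with anchor $a_F(h\otimes X)=hX_F$ and with bracket $$[h\otimes X,k\otimes Y]=hk\otimes[X,Y]+hX_F(k)\otimes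 Y-kY_F(h)\otimes X$$ for $h,k\in C^\infty(F)$, $X,Y\in\Gamma A$. There is a bijection between the derivative representations $\rho$ of $A$ on $E$ associated to the action and the representations $\sigma$ of $A\ltimes F$ on $E$; it sends $\rho$ to the $\sigma$ with $\sigma(h\otimes X)(p)=h(p)\,\rho(X)(p)$, and its inverse sends $\sigma$ to the $\rho$ with $\rho(X)(p)=\sigma(X\circ\varphi)(p)$, for all $h\in C^\infty(F)$, $X\in\Gamma A$, $p\in F$. -/

import Mathlib

open Bundle Manifold VectorField
open scoped ContDiff Manifold

noncomputable section

namespace LieAlgd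

/-! ### Modules of smooth sections -/

section Sections

variable {EM : Type*} [NormedAddCommGroup EM] [NormedSpace ℝ EM]
  {HM : Type*} [TopologicalSpace HM] {I : ModelWithCorners ℝ EM HM}
  {M : Type*} [TopologicalSpace M] [ChartedSpace HM M]
  {V₀ : Type*} [NormedAddCommGroup V₀] [NormedSpace ℝ V₀]
  {V : M → Type*} [TopologicalSpace (TotalSpace V₀ V)] [∀ x, TopologicalSpace (V x)]
  [FiberBundle V₀ V] [∀ x, AddCommGroup (V x)] [∀ x, Module ℝ (V x)] [VectorBundle ℝ V₀ V]

/-- Multiplication of a smooth section by a smooth function. -/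
instance : SMul C^∞⟮I, M; ℝ⟯ Cₛ^∞⟮I; V₀, V⟯ :=
  ⟨fun f s => ⟨fun x => f x • s x, f.contMDiff.smul_section s.contMDiff⟩⟩

@[simp]
theorem fsmul_apply (f : C^∞⟮I, M; ℝ⟯) (s : Cₛ^∞⟮I; V₀, V⟯) (x : M) :
    (f • s) x = f x • s x := rfl

/-- The module structure of `Γ V` over the ring of smooth functions. -/
instance : Module C^∞⟮I, M; ℝ⟯ Cₛ^∞⟮I; V₀, V⟯ where
  one_smul s := by ext x; exact one_smul ℝ (s x)
  mul_smul f g s := by ext x; exact mul_smul (f x) (g x) (s x)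
  smul_zero f := by ext x; exact smul_zero (f x)
  smul_add f s t := by ext x; exact smul_add (f x) (s x) (t x)
  add_smul f g s := by ext x; exact add_smul (f x) (g x) (s x)
  zero_smul s := by ext x; exact zero_smul ℝ (s x)

instance : SMulCommClass ℝ C^∞⟮I, M; ℝ⟯ Cₛ^∞⟮I; V₀, V⟯ :=
  ⟨fun r f s => by ext x; exact smul_comm r (f x) (s x)⟩

end Sections

/-! ### Vector fields -/

section VectorFields

variable {EM : Type*} [NormedAddCommGroup EM] [NormedSpace ℝ EM]
  {HM : Type*} [TopologicalSpace HM] (I : ModelWithCorners ℝ EM HM)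
  (M : Type*) [TopologicalSpace M] [ChartedSpace HM M] [IsManifold I ∞ M]

/-- The space `Γ TM` of smooth vector fields. -/
abbrev VField : Type _ := Cₛ^∞⟮I; EM, (TangentSpace I : M → Type _)⟯

variable {I M}

theorem contMDiff_deriv_apply (f : C^∞⟮I, M; ℝ⟯) (X : VField I M) :
    ContMDiff I 𝓘(ℝ, ℝ) ∞ fun x => mvfderiv I f x (X x) := by
  have h := f.contMDiff.contMDiff_tangentMap (m := ∞) (by simp)
  have h2 := (contMDiff_snd_tangentBundle_modelSpace (n := ∞) ℝ 𝓘(ℝ, ℝ)).comp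
    (h.comp X.contMDiff)
  exact h2

theorem isManifold_minSmoothness (k : ℕ) : IsManifold I (minSmoothness ℝ k) M :=
  IsManifold.of_le (n := ∞) (by simpa using ENat.LEInfty.out)

theorem VField.mdifferentiableAt (X : VField I M) (x : M) :
    MDifferentiableAt I I.tangent (fun y => (⟨y, X y⟩ : TangentBundle I M)) x :=
  X.contMDiff.contMDiffAt.mdifferentiableAt (by simp)

/-- The derivative of a smooth function along a smooth vector field. -/
def deriv (X : VField I M) : C^∞⟮I, M; ℝ⟯ → C^∞⟮I, M; ℝ⟯ :=
  fun f => ⟨fun x => mvfderiv I f x (X x), contMDiff_deriv_apply f X⟩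

theorem deriv_apply (X : VField I M) (f : C^∞⟮I, M; ℝ⟯) (x : M) :
    deriv X f x = mvfderiv I f x (X x) := rfl

variable [CompleteSpace EM]

/-- The Lie bracket of vector fields, as an operation on `Γ TM`. -/
instance : Bracket (VField I M) (VField I M) :=
  ⟨fun X Y => ⟨fun x => mlieBracket I X Y x,
    have : IsManifold I (minSmoothness ℝ 2) M := isManifold_minSmoothness 2
    have : IsManifold I ((⊤ : ℕ∞) + 1) M := IsManifold.of_le (n := ∞) (by simp)
    ContDiff.mlieBracket_vectorField (n := ⊤) (m := ⊤) X.contMDiff Y.contMDiff (by simp)⟩⟩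

theorem lie_apply (X Y : VField I M) (x : M) : ⁅X, Y⁆ x = mlieBracket I X Y x := rfl

/-- The Lie ring of smooth vector fields. -/
instance : LieRing (VField I M) where
  add_lie X Y Z := by
    ext x
    exact mlieBracket_add_left (X.mdifferentiableAt x) (Y.mdifferentiableAt x)
  lie_add X Y Z := by
    ext x
    exact mlieBracket_add_right (Y.mdifferentiableAt x) (Z.mdifferentiableAt x)
  lie_self X := by
    ext x
    simp [lie_apply]
  leibniz_lie X Y Z := by
    have : IsManifold I (minSmoothness ℝ 3) M := isManifold_minSmoothness 3
    ext x
    exact leibniz_identity_mlieBracket_apply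
      (X.contMDiff.contMDiffAt.of_le (by simpa using ENat.LEInfty.out))
      (Y.contMDiff.contMDiffAt.of_le (by simpa using ENat.LEInfty.out))
      (Z.contMDiff.contMDiffAt.of_le (by simpa using ENat.LEInfty.out))

instance : LieAlgebra ℝ (VField I M) where
  lie_smul r X Y := by
    ext x
    exact mlieBracket_const_smul_right (Y.mdifferentiableAt x)

theorem lie_fsmul (X : VField I M) (f : C^∞⟮I, M; ℝ⟯) (Y : VField I M) (x : M) :
    ⁅X, f • Y⁆ x = mvfderiv I f x (X x) • Y x + f x • ⁅X, Y⁆ x :=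
  mlieBracket_smul_right (f.contMDiff.contMDiffAt.mdifferentiableAt (by simp))
    (Y.mdifferentiableAt x)

/-- The bracket of vector fields is the commutator of the associated derivations. -/
theorem deriv_lie (X Y : VField I M) (f : C^∞⟮I, M; ℝ⟯) (x : M) :
    mvfderiv I f x (⁅X, Y⁆ x) =
      mvfderiv I (deriv Y f) x (X x) - mvfderiv I (deriv X f) x (Y x) := by
  have key : ∀ W : VField I M, (mvfderiv I (deriv Y f) x (X x) - mvfderiv I (deriv X f) x (Y x)
      - mvfderiv I f x (⁅X, Y⁆ x)) • W x = 0 := by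
    intro W
    have e := congrArg (fun s : VField I M => s x) (leibniz_lie X Y (f • W))
    have h1 : ∀ Z : VField I M, ⁅Z, f • W⁆ = deriv Z f • W + f • ⁅Z, W⁆ := by
      intro Z; ext y; exact lie_fsmul Z f W y
    have e2 := congrArg (fun s : VField I M => s x) (leibniz_lie X Y W)
    simp only [h1, lie_add, ContMDiffSection.coe_add, Pi.add_apply, lie_fsmul, fsmul_apply,
      deriv_apply] at e e2
    rw [e2] at e
    have := sub_eq_zero.mpr e
    rw [← this]
    module
  by_cases hX : X x = 0
  · by_cases hY : Y x = 0
    · have : ⁅X, Y⁆ x = 0 := by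
        rw [lie_apply, ← mlieBracketWithin_univ]
        exact mlieBracketWithin_eq_zero_of_eq_zero hX hY
      rw [this, hX, hY]
      simp
    · have := (smul_eq_zero.mp (key Y)).resolve_right hY
      linarith
  · have := (smul_eq_zero.mp (key X)).resolve_right hX
    linarith

end VectorFields

/-! ### Lie algebroids -/

section LieAlgebroid

variable {EM : Type*} [NormedAddCommGroup EM] [NormedSpace ℝ EM]
  {HM : Type*} [TopologicalSpace HM] (I : ModelWithCorners ℝ EM HM)
  {M : Type*} [TopologicalSpace M] [ChartedSpace HM M] [IsManifold I ∞ M]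
  (A₀ : Type*) [NormedAddCommGroup A₀] [NormedSpace ℝ A₀]
  (A : M → Type*) [TopologicalSpace (TotalSpace A₀ A)] [∀ x, TopologicalSpace (A x)]
  [FiberBundle A₀ A] [∀ x, AddCommGroup (A x)] [∀ x, Module ℝ (A x)] [VectorBundle ℝ A₀ A]

/-- A Lie algebroid structure on the smooth vector bundle `A` over `M`. -/
structure LieAlgebroid where
  /-- The anchor `a : A → TM`, a smooth vector bundle map over the identity of `M`. -/
  anchor : ∀ x, A x →ₗ[ℝ] TangentSpace I x
  contMDiff_anchor : ContMDiff (I.prod 𝓘(ℝ, A₀)) I.tangent ∞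
    fun v : TotalSpace A₀ A => (⟨v.1, anchor v.1 v.2⟩ : TangentBundle I M)
  /-- The bracket on the space `Γ A` of smooth sections, which is `ℝ`-bilinear. -/
  bracket : Cₛ^∞⟮I; A₀, A⟯ →ₗ[ℝ] Cₛ^∞⟮I; A₀, A⟯ →ₗ[ℝ] Cₛ^∞⟮I; A₀, A⟯
  bracket_self : ∀ X, bracket X X = 0
  jacobi : ∀ X Y Z,
    bracket X (bracket Y Z) + bracket Y (bracket Z X) + bracket Z (bracket X Y) = 0
  anchor_bracket : ∀ X Y x, anchor x (bracket X Y x) =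
    mlieBracket I (fun y => anchor y (X y)) (fun y => anchor y (Y y)) x
  leibniz : ∀ X (f : C^∞⟮I, M; ℝ⟯) Y x, bracket X (f • Y) x =
    f x • bracket X Y x + mvfderiv I f x (anchor x (X x)) • Y x

variable {I A₀ A}

/-- The vector field `a(X)` for a section `X` of a Lie algebroid with anchor `a`. -/
def LieAlgebroid.anchorSection (L : LieAlgebroid I A₀ A) (X : Cₛ^∞⟮I; A₀, A⟯) : VField I M :=
  ⟨fun x => L.anchor x (X x), L.contMDiff_anchor.comp X.contMDiff⟩

end LieAlgebroid

/-! ### The Lie algebroid `𝔇(E)` of derivative endomorphisms -/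

section Derivative

attribute [local instance] LieRing.ofAssociativeRing LieAlgebra.ofAssociativeAlgebra

variable {EM : Type*} [NormedAddCommGroup EM] [NormedSpace ℝ EM]
  {HM : Type*} [TopologicalSpace HM] (I : ModelWithCorners ℝ EM HM)
  {M : Type*} [TopologicalSpace M] [ChartedSpace HM M]
  (E₀ : Type*) [NormedAddCommGroup E₀] [NormedSpace ℝ E₀]
  (E : M → Type*) [TopologicalSpace (TotalSpace E₀ E)] [∀ x, TopologicalSpace (E x)]
  [FiberBundle E₀ E] [∀ x, AddCommGroup (E x)] [∀ x, Module ℝ (E x)] [VectorBundle ℝ E₀ E]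

/-- The fibre `𝔇(E)_p`. Its elements are the pairs of an operator `D : Γ E → E_p` and a tangent
vector `v` at `p` with `D (f ψ) = f(p) D ψ + v(f) ψ(p)`: values at `p` of first order differential
operators with scalar symbol `v`. If `E` has positive rank then `D` determines `v`. -/
def DFiber (p : M) : Submodule ℝ ((Cₛ^∞⟮I; E₀, E⟯ →ₗ[ℝ] E p) × TangentSpace I p) where
  carrier := {D | ∀ (f : C^∞⟮I, M; ℝ⟯) (ψ : Cₛ^∞⟮I; E₀, E⟯),
    D.1 (f • ψ) = f p • D.1 ψ + mvfderiv I f p D.2 • ψ p}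
  zero_mem' f ψ := by simp
  add_mem' {D D'} hD hD' f ψ := by
    simp only [Prod.fst_add, Prod.snd_add, LinearMap.add_apply, map_add, hD f ψ, hD' f ψ]
    module
  smul_mem' r D hD f ψ := by
    simp only [Prod.smul_fst, Prod.smul_snd, LinearMap.smul_apply, map_smul, hD f ψ, smul_eq_mul]
    module

variable {I E₀ E}

/-- The value `D ψ ∈ E_p` of `D ∈ 𝔇(E)_p` on a section `ψ`. -/
def DFiber.apply {p : M} (D : DFiber I E₀ E p) (ψ : Cₛ^∞⟮I; E₀, E⟯) : E p := D.1.1 ψ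

/-- The anchor `𝔇(E)_p → T_p M`. -/
def DFiber.anchor {p : M} (D : DFiber I E₀ E p) : TangentSpace I p := D.1.2

variable [IsManifold I ∞ M]

/-- The smooth structure of the total space of `𝔇(E)`: a map `n ↦ s n ∈ 𝔇(E)_{b n}` from a manifold
`N` into `𝔇(E)` is smooth if and only if its composition with the anchor is a smooth map into `TM`
and its composition with the evaluation `𝔇(E) → E, D ↦ D ψ` is a smooth map into `E` for every
smooth section `ψ` of `E`. -/
def DFiber.IsSmooth {EN : Type*} [NormedAddCommGroup EN] [NormedSpace ℝ EN]
    {HN : Type*} [TopologicalSpace HN] (J : ModelWithCorners ℝ EN HN)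
    {N : Type*} [TopologicalSpace N] [ChartedSpace HN N]
    (b : N → M) (s : ∀ n, DFiber I E₀ E (b n)) : Prop :=
  ContMDiff J I.tangent ∞ (fun n => (⟨b n, DFiber.anchor (s n)⟩ : TangentBundle I M)) ∧
    ∀ ψ : Cₛ^∞⟮I; E₀, E⟯, ContMDiff J (I.prod 𝓘(ℝ, E₀)) ∞
      (fun n => (⟨b n, DFiber.apply (s n) ψ⟩ : TotalSpace E₀ E))

variable [CompleteSpace EM]

variable (I E₀ E) in
/-- The Lie algebra `Γ 𝔇(E)` of derivative endomorphisms: `ℝ`-linear endomorphisms `D` of `Γ E`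
together with a vector field `D_M` such that `D (f ψ) = f D ψ + D_M(f) ψ`, with the commutator
bracket. If `E` has positive rank then `D` determines `D_M`. -/
def DerEnd : LieSubalgebra ℝ (Module.End ℝ Cₛ^∞⟮I; E₀, E⟯ × VField I M) where
  carrier := {D | ∀ (f : C^∞⟮I, M; ℝ⟯) (ψ : Cₛ^∞⟮I; E₀, E⟯),
    D.1 (f • ψ) = f • D.1 ψ + deriv D.2 f • ψ}
  zero_mem' f ψ := by
    ext x
    simp [deriv_apply]
  add_mem' {D D'} hD hD' f ψ := by
    ext x
    simp only [Prod.fst_add, Prod.snd_add, LinearMap.add_apply, hD f ψ, hD' f ψ,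
      ContMDiffSection.coe_add, Pi.add_apply, fsmul_apply, deriv_apply, map_add]
    module
  smul_mem' r D hD f ψ := by
    ext x
    simp only [Prod.smul_fst, Prod.smul_snd, LinearMap.smul_apply, hD f ψ,
      ContMDiffSection.coe_add, ContMDiffSection.coe_smul, Pi.add_apply, Pi.smul_apply,
      fsmul_apply, deriv_apply, map_smul, smul_eq_mul]
    module
  lie_mem' {D D'} hD hD' f ψ := by
    ext x
    have h1 := hD f ψ
    have h2 := hD' f ψ
    simp only [LieAlgebra.Prod.bracket_apply, LieRing.of_associative_ring_bracket,
      LinearMap.sub_apply, Module.End.mul_apply, h1, h2, map_add, hD f, hD' f, hD (deriv D'.2 f),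
      hD' (deriv D.2 f), ContMDiffSection.coe_add, ContMDiffSection.coe_sub, Pi.add_apply,
      Pi.sub_apply, fsmul_apply, deriv_apply, deriv_lie]
    module

namespace DerEnd

/-- The endomorphism of `Γ E` underlying a derivative endomorphism. -/
def op (D : DerEnd I E₀ E) : Module.End ℝ Cₛ^∞⟮I; E₀, E⟯ := D.1.1

/-- The anchor `D ↦ D_M` from derivative endomorphisms to vector fields. -/
def symbol (D : DerEnd I E₀ E) : VField I M := D.1.2

@[ext]
theorem ext {D D' : DerEnd I E₀ E} (h : ∀ ψ, op D ψ = op D' ψ)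
    (h' : symbol D = symbol D') : D = D' :=
  Subtype.ext (Prod.ext (LinearMap.ext h) h')

/-- The action of smooth functions on derivative endomorphisms, `(f D) ψ = f (D ψ)`. -/
instance : SMul C^∞⟮I, M; ℝ⟯ (DerEnd I E₀ E) :=
  ⟨fun g D => ⟨(g • D.1.1, g • D.1.2), fun f ψ => by
    ext x
    have h := D.2 f ψ
    simp only [LinearMap.smul_apply, h, ContMDiffSection.coe_add, Pi.add_apply, fsmul_apply,
      deriv_apply, map_smul, smul_eq_mul]
    module⟩⟩

instance : Module C^∞⟮I, M; ℝ⟯ (DerEnd I E₀ E) where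
  one_smul D := Subtype.ext (one_smul C^∞⟮I, M; ℝ⟯ D.1)
  mul_smul f g D := Subtype.ext (mul_smul f g D.1)
  smul_zero f := Subtype.ext (smul_zero f)
  smul_add f D D' := Subtype.ext (smul_add f D.1 D'.1)
  add_smul f g D := Subtype.ext (add_smul f g D.1)
  zero_smul D := Subtype.ext (zero_smul C^∞⟮I, M; ℝ⟯ D.1)

/-- The value at `p` of a derivative endomorphism, as an element of `𝔇(E)_p`. -/
def eval (D : DerEnd I E₀ E) (p : M) : DFiber I E₀ E p :=
  ⟨({ toFun := fun ψ => op D ψ p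
      map_add' := fun ψ ψ' => by simp
      map_smul' := fun r ψ => by simp }, symbol D p),
    fun f ψ => congrArg (fun s : Cₛ^∞⟮I; E₀, E⟯ => s p) (D.2 f ψ)⟩

/-- The derivative endomorphism given by a smooth section of `𝔇(E)`. -/
def ofSection (s : ∀ p, DFiber I E₀ E p) (hs : DFiber.IsSmooth I (fun p : M => p) s) :
    DerEnd I E₀ E :=
  ⟨({ toFun := fun ψ => ⟨fun p => DFiber.apply (s p) ψ, hs.2 ψ⟩
      map_add' := fun ψ ψ' => by ext p; exact map_add (s p).1.1 ψ ψ'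
      map_smul' := fun r ψ => by ext p; exact map_smul (s p).1.1 r ψ },
    ⟨fun p => DFiber.anchor (s p), hs.1⟩), fun f ψ => by ext p; exact (s p).2 f ψ⟩

/-- Derivative endomorphisms are the same as smooth sections of `𝔇(E)`. -/
theorem isSmooth_iff (s : ∀ p, DFiber I E₀ E p) :
    DFiber.IsSmooth I (fun p : M => p) s ↔ ∃ D : DerEnd I E₀ E, ∀ p, eval D p = s p := by
  constructor
  · intro hs
    exact ⟨ofSection s hs, fun p => rfl⟩
  · rintro ⟨D, hD⟩
    obtain rfl : (fun p => eval D p) = s := funext hD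
    exact ⟨(symbol D).contMDiff, fun ψ => (op D ψ).contMDiff⟩

end DerEnd
end Derivative

/-! ### Representations of a Lie algebroid -/

section Representation

variable {EM : Type*} [NormedAddCommGroup EM] [NormedSpace ℝ EM] [CompleteSpace EM]
  {HM : Type*} [TopologicalSpace HM] {I : ModelWithCorners ℝ EM HM}
  {M : Type*} [TopologicalSpace M] [ChartedSpace HM M] [IsManifold I ∞ M]
  {A₀ : Type*} [NormedAddCommGroup A₀] [NormedSpace ℝ A₀]
  {A : M → Type*} [TopologicalSpace (TotalSpace A₀ A)] [∀ x, TopologicalSpace (A x)]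
  [FiberBundle A₀ A] [∀ x, AddCommGroup (A x)] [∀ x, Module ℝ (A x)] [VectorBundle ℝ A₀ A]
  {E₀ : Type*} [NormedAddCommGroup E₀] [NormedSpace ℝ E₀]
  {E : M → Type*} [TopologicalSpace (TotalSpace E₀ E)] [∀ x, TopologicalSpace (E x)]
  [FiberBundle E₀ E] [∀ x, AddCommGroup (E x)] [∀ x, Module ℝ (E x)] [VectorBundle ℝ E₀ E]

variable (I A₀ A E₀ E) in
/-- A smooth vector bundle map `A → 𝔇(E)` over the identity of `M`. -/
structure BundleMap where
  toFun : ∀ p, A p →ₗ[ℝ] DFiber I E₀ E p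
  isSmooth : DFiber.IsSmooth (I.prod 𝓘(ℝ, A₀)) (fun a : TotalSpace A₀ A => a.1)
    fun a => toFun a.1 a.2

/-- The map `Γ A → Γ 𝔇(E)` induced by a vector bundle map `A → 𝔇(E)`. -/
def BundleMap.onSections (σ : BundleMap I A₀ A E₀ E) (X : Cₛ^∞⟮I; A₀, A⟯) : DerEnd I E₀ E :=
  DerEnd.ofSection (fun p => σ.toFun p (X p))
    ⟨σ.isSmooth.1.comp X.contMDiff, fun ψ => (σ.isSmooth.2 ψ).comp X.contMDiff⟩

variable (E₀ E) in
/-- A representation of a Lie algebroid `A` over `M` on the vector bundle `E` over `M`: a Lie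
algebroid morphism `A → 𝔇(E)` over `M`. -/
structure Representation (L : LieAlgebroid I A₀ A) extends BundleMap I A₀ A E₀ E where
  anchor_comp : ∀ p (a : A p), DFiber.anchor (toFun p a) = L.anchor p a
  map_bracket : ∀ X Y : Cₛ^∞⟮I; A₀, A⟯, toBundleMap.onSections (L.bracket X Y) =
    ⁅toBundleMap.onSections X, toBundleMap.onSections Y⁆

end Representation

/-! ### Infinitesimal actions, action Lie algebroids, derivative representations -/

section Pullback

instance {B B' : Type*} (f : B' → B) (E : B → Type*) [∀ x, AddCommGroup (E x)] (x : B') :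
    AddCommGroup ((f *ᵖ E) x) :=
  inferInstanceAs (AddCommGroup (E (f x)))

variable {EM : Type*} [NormedAddCommGroup EM] [NormedSpace ℝ EM]
  {HM : Type*} [TopologicalSpace HM] {IM : ModelWithCorners ℝ EM HM}
  {M : Type*} [TopologicalSpace M] [ChartedSpace HM M] [IsManifold IM ∞ M]
  {EF : Type*} [NormedAddCommGroup EF] [NormedSpace ℝ EF] [CompleteSpace EF]
  {HF : Type*} [TopologicalSpace HF] {IF : ModelWithCorners ℝ EF HF}
  {F : Type*} [TopologicalSpace F] [ChartedSpace HF F] [IsManifold IF ∞ F]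
  {A₀ : Type*} [NormedAddCommGroup A₀] [NormedSpace ℝ A₀]
  {A : M → Type*} [TopologicalSpace (TotalSpace A₀ A)] [∀ x, TopologicalSpace (A x)]
  [FiberBundle A₀ A] [∀ x, AddCommGroup (A x)] [∀ x, Module ℝ (A x)] [VectorBundle ℝ A₀ A]

/-- The section `X ∘ φ` of `φ^* A` for a smooth section `X` of `A`. -/
def pullbackSection (φ : C^∞⟮IF, F; IM, M⟯) (X : Cₛ^∞⟮IM; A₀, A⟯) :
    Cₛ^∞⟮IF; A₀, (φ *ᵖ A)⟯ where
  toFun p := X (φ p)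
  contMDiff_toFun := by
    intro p
    have h := (Bundle.contMDiffAt_section _).1 (X.contMDiff (φ p))
    exact (Bundle.contMDiffAt_section _).2 (h.comp p (φ.contMDiff p))

/-- An infinitesimal action `X ↦ X_F` of a Lie algebroid `A` over `M` on `φ : F → M`. -/
structure InfinitesimalAction (LA : LieAlgebroid IM A₀ A) (φ : C^∞⟮IF, F; IM, M⟯) where
  toLinearMap : Cₛ^∞⟮IM; A₀, A⟯ →ₗ[ℝ] VField IF F
  /-- The vector field `X_F` is `φ`-related to `a(X)`. -/
  projectable : ∀ X p, mfderiv IF IM φ p (toLinearMap X p) = LA.anchorSection X (φ p)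
  map_bracket : ∀ X Y, toLinearMap (LA.bracket X Y) = ⁅toLinearMap X, toLinearMap Y⁆
  map_fsmul : ∀ (f : C^∞⟮IM, M; ℝ⟯) X, toLinearMap (f • X) = f.comp φ • toLinearMap X

/-- The Lie algebroid structure `L` on the pullback bundle `φ^* A` has the anchor
`h ⊗ X ↦ h X_F` and the bracket
`[h ⊗ X, k ⊗ Y] = h k ⊗ [X, Y] + h X_F(k) ⊗ Y - k Y_F(h) ⊗ X`,
where `h ⊗ X` is the section `h (X ∘ φ)` of `φ^* A`. -/
structure IsActionLieAlgebroid {LA : LieAlgebroid IM A₀ A} {φ : C^∞⟮IF, F; IM, M⟯}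
    (act : InfinitesimalAction LA φ) (L : LieAlgebroid IF A₀ (φ *ᵖ A)) : Prop where
  anchor_eq : ∀ (h : C^∞⟮IF, F; ℝ⟯) X,
    L.anchorSection (h • pullbackSection φ X) = h • act.toLinearMap X
  bracket_eq : ∀ (h k : C^∞⟮IF, F; ℝ⟯) X Y,
    L.bracket (h • pullbackSection φ X) (k • pullbackSection φ Y) =
      (h * k) • pullbackSection φ (LA.bracket X Y)
        + (h * deriv (act.toLinearMap X) k) • pullbackSection φ Y
        - (k * deriv (act.toLinearMap Y) h) • pullbackSection φ X

variable {LA : LieAlgebroid IM A₀ A} {φ : C^∞⟮IF, F; IM, M⟯}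
  (E₀ : Type*) [NormedAddCommGroup E₀] [NormedSpace ℝ E₀]
  (E : F → Type*) [TopologicalSpace (TotalSpace E₀ E)] [∀ x, TopologicalSpace (E x)]
  [FiberBundle E₀ E] [∀ x, AddCommGroup (E x)] [∀ x, Module ℝ (E x)] [VectorBundle ℝ E₀ E]

/-- A derivative representation of `A` on the vector bundle `E` over `F`, associated to the
infinitesimal action `X ↦ X_F` of `A` on `F`. -/
structure DerivativeRep (act : InfinitesimalAction LA φ) where
  toLinearMap : Cₛ^∞⟮IM; A₀, A⟯ →ₗ[ℝ] DerEnd IF E₀ E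
  map_bracket : ∀ X Y, toLinearMap (LA.bracket X Y) = ⁅toLinearMap X, toLinearMap Y⁆
  symbol_eq : ∀ X, DerEnd.symbol (toLinearMap X) = act.toLinearMap X
  map_fsmul : ∀ (f : C^∞⟮IM, M; ℝ⟯) X, toLinearMap (f • X) = f.comp φ • toLinearMap X

end Pullback

end LieAlgd

end

/-! Sections of `φ^* A` are locally finite sums `∑ hᵢ ⊗ Xᵢ` with `Xᵢ` global sections of `A`. So a
map that is `C^∞(F)`-linear, or obeys a Leibniz rule along a known vector field, is determined by
its values on pullbacks `X ∘ φ`. Conversely, values prescribed on pullbacks extend as soon as they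
are compatible with multiplication by functions from `M`. The local sums come from
`LocalGenerators`: a frame and its coefficients, multiplied by bump functions so that everything is
globally defined.

Extension has two forms. Tensorial data descend to fibres (`descend`), which gives the anchor and
the bundle map `σ`; smoothness is tested on pullbacks (`contMDiff_of_pullbackSection`). Leibniz data
extend to derivative endomorphisms of `φ^* A` (`DerivationAlong.extension`). The bracket arises by
extending twice: `Y ↦ [X, Y] ∘ φ` extends along `X_F` to `adjoint X`; then, for a fixed section `s`
of `φ^* A`, the map `X ↦ -adjoint X s` extends along `a_F(s)` to `[s, ·]`.

Each remaining identity (skew symmetry, the anchor as a morphism, uniqueness, compatibility of `σ`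
with brackets) says that some defect vanishes. The Leibniz terms cancel, so the defect is tensorial,
and on pullbacks it vanishes by the corresponding property of `A`, of the action or of `ρ`. The
Jacobi identity follows similarly, by comparing the derivative endomorphisms `[[s, ·], [t, ·]]` and
`[[s, t], ·]`. -/

noncomputable section

namespace LieAlgd

open Topology Module

/-! ### Local generators of the module of smooth sections -/

section Generators

variable {EM : Type*} [NormedAddCommGroup EM] [NormedSpace ℝ EM]
  {HM : Type*} [TopologicalSpace HM] (IM : ModelWithCorners ℝ EM HM)
  {M : Type*} [TopologicalSpace M] [ChartedSpace HM M]
  (A₀ : Type*) [NormedAddCommGroup A₀] [NormedSpace ℝ A₀]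
  (A : M → Type*) [TopologicalSpace (TotalSpace A₀ A)] [∀ x, TopologicalSpace (A x)]
  [FiberBundle A₀ A] [∀ x, AddCommGroup (A x)] [∀ x, Module ℝ (A x)] [VectorBundle ℝ A₀ A]

/-- Finitely many global smooth sections `sec i` and smooth fibrewise linear functions `coef i`
with `g • a = ∑ i, coef i a • sec i`, where the smooth function `g` is equal to `1` near `m`. -/
structure LocalGenerators (m : M) where
  sec : Fin (finrank ℝ A₀) → Cₛ^∞⟮IM; A₀, A⟯
  coef : Fin (finrank ℝ A₀) → ∀ x, A x →ₗ[ℝ] ℝ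
  contMDiff_coef : ∀ i, ContMDiff (IM.prod 𝓘(ℝ, A₀)) 𝓘(ℝ, ℝ) ∞
    fun v : TotalSpace A₀ A => coef i v.1 v.2
  cutoff : C^∞⟮IM, M; ℝ⟯
  cutoff_eq_one : ∀ᶠ x in 𝓝 m, cutoff x = 1
  sum_coef_smul : ∀ x (a : A x), ∑ i, coef i x a • sec i x = cutoff x • a

variable {A₀ A}

/-- A bump function `f` supported in a trivializing neighbourhood extends by zero both the local
frame and its dual coefficients. As `f` enters once in each, the cutoff is `f * f`. -/
theorem exists_localGenerators [FiniteDimensional ℝ EM] [IsManifold IM ∞ M] [T2Space M]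
    [FiniteDimensional ℝ A₀] [ContMDiffVectorBundle ∞ A₀ A IM] (m : M) :
    Nonempty (LocalGenerators IM A₀ A m) := by
  let e := trivializationAt A₀ A m
  let b := finBasis ℝ A₀
  have hm : m ∈ e.baseSet := FiberBundle.mem_baseSet_trivializationAt A₀ A m
  obtain ⟨f, -, hf⟩ := (SmoothBumpFunction.nhds_basis_tsupport (I := IM) m).mem_iff.1
    (e.open_baseSet.mem_nhds hm)
  have hf0 : ∀ x, x ∉ e.baseSet → f x = 0 := fun x hx => by
    by_contra h
    exact hx (hf (subset_tsupport _ h))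
  -- Vanishing on a whole neighbourhood, not just at `x`, is what gives smoothness outside the
  -- trivializing set.
  have hnear : ∀ x, x ∉ e.baseSet → ∀ᶠ y in 𝓝 x, f y = 0 := fun x hx => by
    have := (isClosed_tsupport f).isOpen_compl.mem_nhds (fun h => hx (hf h))
    filter_upwards [this] with y hy
    by_contra h
    exact hy (subset_tsupport _ h)
  refine ⟨⟨fun i => ⟨fun x => f x • e.localFrame b i x, ?_⟩,
    fun i x => f x • (b.coord i ∘ₗ e.linearMapAt ℝ x), ?_, ⟨fun x => f x * f x, ?_⟩, ?_, ?_⟩⟩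
  · intro x
    by_cases hx : x ∈ e.baseSet
    · exact f.contMDiffAt.smul_section (contMDiffAt_localFrame_of_mem ∞ e b i hx)
    · refine (contMDiffAt_zeroSection ℝ A (F := A₀) (x := x)).congr_of_eventuallyEq ?_
      filter_upwards [hnear x hx] with y hy
      simp [hy, zeroSection]
  · intro i v
    have hproj := (contMDiff_proj A (IB := IM) (n := ∞) (F := A₀)).continuous.continuousAt (x := v)
    by_cases hx : v.1 ∈ e.baseSet
    · have h1 := (e.contMDiffAt_iff (IB := IM) (IM := IM.prod 𝓘(ℝ, A₀)) (n := ∞)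
        (f := fun w => w) (x₀ := v) (e.mem_source.2 hx)).1 contMDiffAt_id
      have h2 : ContMDiff 𝓘(ℝ, A₀) 𝓘(ℝ, ℝ) ∞ (b.coord i) :=
        (LinearMap.toContinuousLinearMap (b.coord i)).contDiff.contMDiff
      have h3 := (f.contMDiff.contMDiffAt.comp v h1.1).smul (h2.contMDiffAt.comp v h1.2)
      refine h3.congr_of_eventuallyEq ?_
      filter_upwards [hproj (e.open_baseSet.mem_nhds hx)] with w hw
      simp [e.coe_linearMapAt_of_mem (R := ℝ) (show w.1 ∈ e.baseSet from hw)]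
    · refine (contMDiffAt_const (c := (0 : ℝ))).congr_of_eventuallyEq ?_
      filter_upwards [hproj.eventually (hnear v.1 hx)] with w hw
      simp [hw]
  · exact f.contMDiff.mul f.contMDiff
  · filter_upwards [f.eventuallyEq_one] with x hx
    show f x * f x = 1
    simp [hx]
  · intro x a
    by_cases hx : x ∈ e.baseSet
    · have : ∑ i, (b.coord i (e.linearMapAt ℝ x a)) • e.localFrame b i x = a := by
        have h := (e.basisAt b hx).sum_repr a
        simp only [e.localFrame_apply_of_mem_baseSet b hx]
        convert! h using 3
        simp [Bundle.Trivialization.basisAt, e.coe_linearMapAt_of_mem (R := ℝ) hx]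
      show ∑ i, (f x • b.coord i (e.linearMapAt ℝ x a)) • f x • e.localFrame b i x
        = (f x * f x) • a
      conv_rhs => rw [← this]
      rw [Finset.smul_sum]
      refine Finset.sum_congr rfl fun i _ => ?_
      simp only [smul_smul, smul_eq_mul]
      congr 1
      ring
    · show ∑ i, (f x • b.coord i (e.linearMapAt ℝ x a)) • f x • e.localFrame b i x
        = (f x * f x) • a
      simp [hf0 x hx]

end Generators

/-! ### Sections along a map -/

section Along

variable {EB : Type*} [NormedAddCommGroup EB] [NormedSpace ℝ EB]
  {HB : Type*} [TopologicalSpace HB] {IB : ModelWithCorners ℝ EB HB}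
  {B : Type*} [TopologicalSpace B] [ChartedSpace HB B]
  {EN : Type*} [NormedAddCommGroup EN] [NormedSpace ℝ EN]
  {HN : Type*} [TopologicalSpace HN] {IN : ModelWithCorners ℝ EN HN}
  {N : Type*} [TopologicalSpace N] [ChartedSpace HN N]
  {EP : Type*} [NormedAddCommGroup EP] [NormedSpace ℝ EP]
  {HP : Type*} [TopologicalSpace HP] {IP : ModelWithCorners ℝ EP HP}
  {P : Type*} [TopologicalSpace P] [ChartedSpace HP P]
  {V₀ : Type*} [NormedAddCommGroup V₀] [NormedSpace ℝ V₀]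
  {V : B → Type*} [TopologicalSpace (TotalSpace V₀ V)] [∀ x, TopologicalSpace (V x)]
  [FiberBundle V₀ V] [∀ x, AddCommGroup (V x)] [∀ x, Module ℝ (V x)] [VectorBundle ℝ V₀ V]

/-- A smooth map into the total space of a pullback bundle induces a smooth map into the total
space of the bundle. -/
theorem contMDiff_lift_comp (b : C^∞⟮IN, N; IB, B⟯) {u : P → TotalSpace V₀ (b *ᵖ V)}
    (hu : ContMDiff IP (IN.prod 𝓘(ℝ, V₀)) ∞ u) :
    ContMDiff IP (IB.prod 𝓘(ℝ, V₀)) ∞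
      fun x => (⟨b (u x).1, (u x).2⟩ : TotalSpace V₀ V) := by
  intro x
  have h := contMDiffAt_totalSpace.1 (hu x)
  exact contMDiffAt_totalSpace.2 ⟨(b.contMDiff _).comp x h.1, h.2⟩

/-- A section of a pullback bundle is smooth if and only if it is smooth as a map into the total
space of the bundle. -/
theorem contMDiff_pullback_section_iff (b : C^∞⟮IN, N; IB, B⟯) (s : ∀ n, V (b n)) :
    ContMDiff IN (IN.prod 𝓘(ℝ, V₀)) ∞ (fun n => (⟨n, s n⟩ : TotalSpace V₀ (b *ᵖ V))) ↔
      ContMDiff IN (IB.prod 𝓘(ℝ, V₀)) ∞ (fun n => (⟨b n, s n⟩ : TotalSpace V₀ V)) := by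
  refine ⟨fun h => contMDiff_lift_comp b h, fun h n => ?_⟩
  exact (contMDiffAt_section _).2 (contMDiffAt_totalSpace.1 (h n)).2

end Along

/-! ### Derivatives along vector fields -/

section Deriv

variable {EM : Type*} [NormedAddCommGroup EM] [NormedSpace ℝ EM]
  {HM : Type*} [TopologicalSpace HM] {I : ModelWithCorners ℝ EM HM}
  {M : Type*} [TopologicalSpace M] [ChartedSpace HM M] [IsManifold I ∞ M]

theorem mdifferentiableAt_smoothMap (f : C^∞⟮I, M; ℝ⟯) (x : M) :
    MDifferentiableAt I 𝓘(ℝ, ℝ) f x :=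
  f.contMDiff.contMDiffAt.mdifferentiableAt (by simp)

theorem deriv_fun_add (X : VField I M) (f g : C^∞⟮I, M; ℝ⟯) :
    deriv X (f + g) = deriv X f + deriv X g := by
  ext x
  show mvfderiv I (⇑f + ⇑g) x (X x) = mvfderiv I f x (X x) + mvfderiv I g x (X x)
  rw [mvfderiv_add (mdifferentiableAt_smoothMap f x) (mdifferentiableAt_smoothMap g x)]
  rfl

theorem deriv_fun_mul (X : VField I M) (f g : C^∞⟮I, M; ℝ⟯) :
    deriv X (f * g) = f * deriv X g + deriv X f * g := by
  ext x
  show mvfderiv I (⇑f * ⇑g) x (X x) = f x * mvfderiv I g x (X x) + mvfderiv I f x (X x) * g x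
  rw [mvfderiv_mul (mdifferentiableAt_smoothMap f x) (mdifferentiableAt_smoothMap g x)]
  simp [mul_comm]

theorem deriv_fun_const_smul (X : VField I M) (r : ℝ) (f : C^∞⟮I, M; ℝ⟯) :
    deriv X (r • f) = r • deriv X f := by
  ext x
  show mvfderiv I (r • ⇑f) x (X x) = r * mvfderiv I f x (X x)
  have h : (r • ⇑f) = (fun _ : M => r) • ⇑f := rfl
  rw [h, mvfderiv_smul mdifferentiableAt_const (mdifferentiableAt_smoothMap f x)]
  have h0 : mvfderiv I (fun _ : M => r) x = 0 := mvfderiv_const r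
  simp [h0]

theorem deriv_fsmul_field (h : C^∞⟮I, M; ℝ⟯) (X : VField I M) (f : C^∞⟮I, M; ℝ⟯) :
    deriv (h • X) f = h * deriv X f := by
  ext x
  exact map_smul (mvfderiv I f x) (h x) (X x)

/-- A function that is locally constant near `x` has zero derivative at `x`. -/
theorem deriv_eq_zero_of_eventually_eq (X : VField I M) {f : C^∞⟮I, M; ℝ⟯} {x : M} {r : ℝ}
    (h : ∀ᶠ y in 𝓝 x, f y = r) : deriv X f x = 0 := by
  have h' : (f : M → ℝ) =ᶠ[𝓝 x] fun _ => r := h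
  rw [deriv_apply, mvfderiv, h'.mfderiv_eq]
  have := congrArg (fun l => l (X x)) (mvfderiv_const (I := I) r (x := x))
  exact this

theorem deriv_one (X : VField I M) : deriv X (1 : C^∞⟮I, M; ℝ⟯) = 0 := by
  ext x
  exact deriv_eq_zero_of_eventually_eq (r := 1) X (Filter.Eventually.of_forall fun _ => rfl)

theorem lie_fsmul_eq [CompleteSpace EM] (X : VField I M) (f : C^∞⟮I, M; ℝ⟯) (Y : VField I M) :
    ⁅X, f • Y⁆ = f • ⁅X, Y⁆ + deriv X f • Y := by
  ext x
  rw [lie_fsmul, add_comm]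
  rfl

end Deriv

/-! ### Evaluation of sections -/

section Eval

variable {EM : Type*} [NormedAddCommGroup EM] [NormedSpace ℝ EM]
  {HM : Type*} [TopologicalSpace HM] {I : ModelWithCorners ℝ EM HM}
  {M : Type*} [TopologicalSpace M] [ChartedSpace HM M]
  {A₀ : Type*} [NormedAddCommGroup A₀] [NormedSpace ℝ A₀]
  {A : M → Type*} [TopologicalSpace (TotalSpace A₀ A)] [∀ x, TopologicalSpace (A x)]
  [FiberBundle A₀ A] [∀ x, AddCommGroup (A x)] [∀ x, Module ℝ (A x)] [VectorBundle ℝ A₀ A]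

instance : IsScalarTower ℝ C^∞⟮I, M; ℝ⟯ Cₛ^∞⟮I; A₀, A⟯ :=
  ⟨fun r f s => by ext x; exact smul_assoc r (f x) (s x)⟩

variable (I A₀ A) in
/-- The value of a smooth section at a point, as a linear map. -/
def evalAt (x : M) : Cₛ^∞⟮I; A₀, A⟯ →ₗ[ℝ] A x where
  toFun X := X x
  map_add' _ _ := rfl
  map_smul' _ _ := rfl

theorem section_sum_apply {ι : Type*} (t : Finset ι) (X : ι → Cₛ^∞⟮I; A₀, A⟯) (x : M) :
    (∑ i ∈ t, X i) x = ∑ i ∈ t, X i x :=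
  map_sum (evalAt I A₀ A x) X t

namespace LocalGenerators

variable {m : M} (G : LocalGenerators I A₀ A m)

theorem cutoff_self : G.cutoff m = 1 := G.cutoff_eq_one.self_of_nhds

/-- The coefficients of a smooth section. -/
def coefSection (i : Fin (finrank ℝ A₀)) (X : Cₛ^∞⟮I; A₀, A⟯) : C^∞⟮I, M; ℝ⟯ :=
  ⟨fun x => G.coef i x (X x), (G.contMDiff_coef i).comp X.contMDiff⟩

theorem sum_coefSection_smul (X : Cₛ^∞⟮I; A₀, A⟯) :
    ∑ i, G.coefSection i X • G.sec i = G.cutoff • X := by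
  ext x
  rw [section_sum_apply]
  exact G.sum_coef_smul x (X x)

end LocalGenerators

variable [FiniteDimensional ℝ EM] [IsManifold I ∞ M] [T2Space M]
    [FiniteDimensional ℝ A₀] [ContMDiffVectorBundle ∞ A₀ A I]

variable (I A₀ A) in
/-- A choice of local generators near each point. -/
def localGenerators (m : M) : LocalGenerators I A₀ A m :=
  (exists_localGenerators I m).some

variable (I A₀) in
theorem exists_section_apply_eq {m : M} (a : A m) : ∃ X : Cₛ^∞⟮I; A₀, A⟯, X m = a := by
  let G := localGenerators I A₀ A m
  refine ⟨∑ i, G.coef i m a • G.sec i, ?_⟩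
  rw [section_sum_apply]
  simpa [G.cutoff_self] using G.sum_coef_smul m a

variable (I A₀) in
/-- A linear map on smooth sections that is tensorial at `m` descends to the fibre at `m`. -/
def descend {m : M} {W : Type*} [AddCommGroup W] [Module ℝ W] (l : Cₛ^∞⟮I; A₀, A⟯ →ₗ[ℝ] W) :
    A m →ₗ[ℝ] W :=
  ∑ i, ((localGenerators I A₀ A m).coef i m).smulRight (l ((localGenerators I A₀ A m).sec i))

/-- Since the cutoff is `1` at `m`, tensoriality gives `l X = l (cutoff • X)`; expanding `cutoff •
X` in the generators leaves only the coefficients of `X m`. -/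
theorem descend_apply {m : M} {W : Type*} [AddCommGroup W] [Module ℝ W]
    (l : Cₛ^∞⟮I; A₀, A⟯ →ₗ[ℝ] W) (hl : ∀ (f : C^∞⟮I, M; ℝ⟯) X, l (f • X) = f m • l X)
    (X : Cₛ^∞⟮I; A₀, A⟯) : descend I A₀ l (X m) = l X := by
  let G := localGenerators I A₀ A m
  have h := congrArg l (G.sum_coefSection_smul X)
  rw [map_sum, hl, G.cutoff_self, one_smul] at h
  rw [← h, descend, LinearMap.sum_apply]
  refine Finset.sum_congr rfl fun i _ => ?_
  rw [hl]
  rfl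

end Eval

/-! ### Sections of a pullback bundle -/

section PullbackSections

variable {EM : Type*} [NormedAddCommGroup EM] [NormedSpace ℝ EM]
  {HM : Type*} [TopologicalSpace HM] {IM : ModelWithCorners ℝ EM HM}
  {M : Type*} [TopologicalSpace M] [ChartedSpace HM M]
  {EF : Type*} [NormedAddCommGroup EF] [NormedSpace ℝ EF]
  {HF : Type*} [TopologicalSpace HF] {IF : ModelWithCorners ℝ EF HF}
  {F : Type*} [TopologicalSpace F] [ChartedSpace HF F]
  {A₀ : Type*} [NormedAddCommGroup A₀] [NormedSpace ℝ A₀]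
  {A : M → Type*} [TopologicalSpace (TotalSpace A₀ A)] [∀ x, TopologicalSpace (A x)]
  [FiberBundle A₀ A] [∀ x, AddCommGroup (A x)] [∀ x, Module ℝ (A x)] [VectorBundle ℝ A₀ A]
  {φ : C^∞⟮IF, F; IM, M⟯}

theorem pullbackSection_add (X Y : Cₛ^∞⟮IM; A₀, A⟯) :
    pullbackSection φ (X + Y) = pullbackSection φ X + pullbackSection φ Y := rfl

theorem pullbackSection_const_smul (r : ℝ) (X : Cₛ^∞⟮IM; A₀, A⟯) :
    pullbackSection φ (r • X) = r • pullbackSection φ X := rfl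

theorem pullbackSection_fsmul (f : C^∞⟮IM, M; ℝ⟯) (X : Cₛ^∞⟮IM; A₀, A⟯) :
    pullbackSection φ (f • X) = f.comp φ • pullbackSection φ X := rfl

namespace LocalGenerators

variable {m : M} (G : LocalGenerators IM A₀ A m)

/-- The coefficients of a smooth section of the pullback bundle. -/
def coefPullback (i : Fin (finrank ℝ A₀)) (s : Cₛ^∞⟮IF; A₀, (φ *ᵖ A)⟯) : C^∞⟮IF, F; ℝ⟯ :=
  ⟨fun p => G.coef i (φ p) (s p), (G.contMDiff_coef i).comp (contMDiff_lift_comp φ s.contMDiff)⟩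

theorem coefPullback_add (i : Fin (finrank ℝ A₀)) (s t : Cₛ^∞⟮IF; A₀, (φ *ᵖ A)⟯) :
    G.coefPullback i (s + t) = G.coefPullback i s + G.coefPullback i t := by
  ext p
  exact map_add (G.coef i (φ p)) (s p) (t p)

theorem coefPullback_const_smul (i : Fin (finrank ℝ A₀)) (r : ℝ)
    (s : Cₛ^∞⟮IF; A₀, (φ *ᵖ A)⟯) : G.coefPullback i (r • s) = r • G.coefPullback i s := by
  ext p
  exact map_smul (G.coef i (φ p)) r (s p)

theorem coefPullback_fsmul (i : Fin (finrank ℝ A₀)) (h : C^∞⟮IF, F; ℝ⟯)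
    (s : Cₛ^∞⟮IF; A₀, (φ *ᵖ A)⟯) : G.coefPullback i (h • s) = h * G.coefPullback i s := by
  ext p
  exact map_smul (G.coef i (φ p)) (h p) (s p)

theorem sum_coefPullback_smul (s : Cₛ^∞⟮IF; A₀, (φ *ᵖ A)⟯) :
    ∑ i, G.coefPullback i s • pullbackSection φ (G.sec i) = G.cutoff.comp φ • s := by
  ext p
  rw [section_sum_apply]
  exact G.sum_coef_smul (φ p) (s p)

end LocalGenerators

variable [FiniteDimensional ℝ EM] [IsManifold IM ∞ M] [T2Space M]
    [FiniteDimensional ℝ A₀] [ContMDiffVectorBundle ∞ A₀ A IM]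

/-- A linear map on sections of the pullback bundle that is tensorial at `p` vanishes if it
vanishes on pullbacks of sections. -/
theorem eq_zero_of_pullbackSection {p : F} {W : Type*} [AddCommGroup W] [Module ℝ W]
    (δ : Cₛ^∞⟮IF; A₀, (φ *ᵖ A)⟯ →ₗ[ℝ] W)
    (hδ : ∀ (h : C^∞⟮IF, F; ℝ⟯) s, δ (h • s) = h p • δ s)
    (h0 : ∀ X : Cₛ^∞⟮IM; A₀, A⟯, δ (pullbackSection φ X) = 0) (s : Cₛ^∞⟮IF; A₀, (φ *ᵖ A)⟯) :
    δ s = 0 := by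
  let G := localGenerators IM A₀ A (φ p)
  have h := congrArg δ (G.sum_coefPullback_smul s)
  have h1 : (G.cutoff.comp φ) p = 1 := G.cutoff_self
  rw [map_sum, hδ, h1, one_smul] at h
  rw [← h]
  exact Finset.sum_eq_zero fun i _ => by rw [hδ, h0, smul_zero]

/-- An antisymmetric bilinear map on sections of the pullback bundle that is tensorial at `p`
vanishes if it vanishes on pullbacks of sections. -/
theorem bilin_eq_zero_of_pullbackSection {p : F} {W : Type*} [AddCommGroup W] [Module ℝ W]
    (β : Cₛ^∞⟮IF; A₀, (φ *ᵖ A)⟯ →ₗ[ℝ] Cₛ^∞⟮IF; A₀, (φ *ᵖ A)⟯ →ₗ[ℝ] W)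
    (hanti : ∀ s t, β s t = -β t s)
    (hβ : ∀ s (h : C^∞⟮IF, F; ℝ⟯) t, β s (h • t) = h p • β s t)
    (h0 : ∀ X Y : Cₛ^∞⟮IM; A₀, A⟯, β (pullbackSection φ X) (pullbackSection φ Y) = 0)
    (s t : Cₛ^∞⟮IF; A₀, (φ *ᵖ A)⟯) : β s t = 0 := by
  -- Tensoriality is assumed in the second slot only; antisymmetry moves the other argument there.
  refine eq_zero_of_pullbackSection (β s) (hβ s) (fun Y => ?_) t
  rw [hanti, neg_eq_zero]
  exact eq_zero_of_pullbackSection (β _) (hβ _) (fun X => h0 Y X) s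

/-- A fibrewise linear map on the pullback bundle is smooth if it maps pullbacks of smooth sections
to smooth sections. -/
theorem contMDiff_of_pullbackSection {V₀ : Type*} [NormedAddCommGroup V₀] [NormedSpace ℝ V₀]
    {V : F → Type*} [TopologicalSpace (TotalSpace V₀ V)] [∀ x, TopologicalSpace (V x)]
    [FiberBundle V₀ V] [∀ x, AddCommGroup (V x)] [∀ x, Module ℝ (V x)] [VectorBundle ℝ V₀ V]
    (τ : ∀ p, (φ *ᵖ A) p →ₗ[ℝ] V p)
    (hτ : ∀ X : Cₛ^∞⟮IM; A₀, A⟯, ContMDiff IF (IF.prod 𝓘(ℝ, V₀)) ∞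
      fun p => (⟨p, τ p (pullbackSection φ X p)⟩ : TotalSpace V₀ V)) :
    ContMDiff (IF.prod 𝓘(ℝ, A₀)) (IF.prod 𝓘(ℝ, V₀)) ∞
      fun v : TotalSpace A₀ (φ *ᵖ A) => (⟨v.1, τ v.1 v.2⟩ : TotalSpace V₀ V) := by
  intro v₀
  let G := localGenerators IM A₀ A (φ v₀.1)
  let b : C^∞⟮IF.prod 𝓘(ℝ, A₀), TotalSpace A₀ (φ *ᵖ A); IF, F⟯ :=
    ⟨TotalSpace.proj, contMDiff_proj _⟩
  have hsum : ContMDiff (IF.prod 𝓘(ℝ, A₀)) (IF.prod 𝓘(ℝ, V₀)) ∞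
      fun v : TotalSpace A₀ (φ *ᵖ A) =>
        (⟨b v, ∑ i, G.coef i (φ v.1) v.2 • τ v.1 (pullbackSection φ (G.sec i) v.1)⟩ :
          TotalSpace V₀ V) := by
    -- A map into `V` covering the bundle projection `b` is a section of `b *ᵖ V`, for which sums
    -- and products with functions are known to be smooth.
    refine (contMDiff_pullback_section_iff b _).1 ?_
    refine ContMDiff.sum_section (V := b *ᵖ V) fun i _ => ?_
    refine ContMDiff.smul_section (V := b *ᵖ V) ?_ ?_
    · exact (G.contMDiff_coef i).comp (contMDiff_lift_comp φ contMDiff_id)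
    · exact (contMDiff_pullback_section_iff b _).2 ((hτ (G.sec i)).comp b.contMDiff)
  refine (hsum v₀).congr_of_eventuallyEq ?_
  have hc : ContinuousAt (fun v : TotalSpace A₀ (φ *ᵖ A) => φ v.1) v₀ :=
    (φ.contMDiff.continuous.comp b.contMDiff.continuous).continuousAt
  filter_upwards [hc.eventually G.cutoff_eq_one] with v hv
  have h : ∑ i, (G.coef i (φ v.1) v.2 • pullbackSection φ (G.sec i) v.1 : (φ *ᵖ A) v.1) = v.2 := by
    refine (G.sum_coef_smul (φ v.1) v.2).trans ?_
    rw [hv]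
    exact one_smul ℝ (v.2 : A (φ v.1))
  have h' := congrArg (τ v.1) h
  rw [map_sum] at h'
  rw [TotalSpace.mk.injEq]
  refine ⟨rfl, heq_of_eq ?_⟩
  rw [← h']
  exact Finset.sum_congr rfl fun i _ => map_smul (τ v.1) _ _

end PullbackSections

/-! ### Calculus of derivative endomorphisms -/

section DerEndLemmas

variable {EM : Type*} [NormedAddCommGroup EM] [NormedSpace ℝ EM] [CompleteSpace EM]
  {HM : Type*} [TopologicalSpace HM] {I : ModelWithCorners ℝ EM HM}
  {M : Type*} [TopologicalSpace M] [ChartedSpace HM M] [IsManifold I ∞ M]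
  {E₀ : Type*} [NormedAddCommGroup E₀] [NormedSpace ℝ E₀]
  {E : M → Type*} [TopologicalSpace (TotalSpace E₀ E)] [∀ x, TopologicalSpace (E x)]
  [FiberBundle E₀ E] [∀ x, AddCommGroup (E x)] [∀ x, Module ℝ (E x)] [VectorBundle ℝ E₀ E]

namespace DerEnd

theorem op_fsmul (D : DerEnd I E₀ E) (f : C^∞⟮I, M; ℝ⟯) (ψ : Cₛ^∞⟮I; E₀, E⟯) :
    op D (f • ψ) = f • op D ψ + deriv (symbol D) f • ψ := D.2 f ψ

theorem op_lie (D D' : DerEnd I E₀ E) (ψ : Cₛ^∞⟮I; E₀, E⟯) :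
    op ⁅D, D'⁆ ψ = op D (op D' ψ) - op D' (op D ψ) := rfl

theorem lie_fsmul (D : DerEnd I E₀ E) (f : C^∞⟮I, M; ℝ⟯) (D' : DerEnd I E₀ E) :
    ⁅D, f • D'⁆ = f • ⁅D, D'⁆ + deriv (symbol D) f • D' := by
  refine DerEnd.ext (fun ψ => ?_) ?_
  · show op D (f • op D' ψ) - f • op D' (op D ψ) =
      f • (op D (op D' ψ) - op D' (op D ψ)) + deriv (symbol D) f • op D' ψ
    rw [op_fsmul]
    module
  · exact lie_fsmul_eq (symbol D) f (symbol D')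

/-- Evaluation of derivative endomorphisms at a point, as a linear map. -/
def evalₗ (p : M) : DerEnd I E₀ E →ₗ[ℝ] DFiber I E₀ E p where
  toFun D := eval D p
  map_add' _ _ := rfl
  map_smul' _ _ := rfl

theorem eval_injective {D D' : DerEnd I E₀ E} (h : ∀ p, eval D p = eval D' p) : D = D' := by
  refine DerEnd.ext (fun ψ => ?_) ?_
  · ext p
    exact congrArg (fun d => DFiber.apply d ψ) (h p)
  · ext p
    exact congrArg DFiber.anchor (h p)

end DerEnd

end DerEndLemmas

/-! ### Extension of derivations to the pullback bundle -/

section Extension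

variable {EM : Type*} [NormedAddCommGroup EM] [NormedSpace ℝ EM]
  {HM : Type*} [TopologicalSpace HM] {IM : ModelWithCorners ℝ EM HM}
  {M : Type*} [TopologicalSpace M] [ChartedSpace HM M]
  {EF : Type*} [NormedAddCommGroup EF] [NormedSpace ℝ EF]
  {HF : Type*} [TopologicalSpace HF] {IF : ModelWithCorners ℝ EF HF}
  {F : Type*} [TopologicalSpace F] [ChartedSpace HF F] [IsManifold IF ∞ F]
  {A₀ : Type*} [NormedAddCommGroup A₀] [NormedSpace ℝ A₀]
  {A : M → Type*} [TopologicalSpace (TotalSpace A₀ A)] [∀ x, TopologicalSpace (A x)]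
  [FiberBundle A₀ A] [∀ x, AddCommGroup (A x)] [∀ x, Module ℝ (A x)] [VectorBundle ℝ A₀ A]

/-- An `ℝ`-linear map `δ : Γ A → Γ (φ^* A)` that satisfies the Leibniz rule along the vector field
`w` on `F`. -/
structure DerivationAlong (A₀ : Type*) [NormedAddCommGroup A₀] [NormedSpace ℝ A₀]
    (A : M → Type*) [TopologicalSpace (TotalSpace A₀ A)] [∀ x, TopologicalSpace (A x)]
    [FiberBundle A₀ A] [∀ x, AddCommGroup (A x)] [∀ x, Module ℝ (A x)] [VectorBundle ℝ A₀ A]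
    (φ : C^∞⟮IF, F; IM, M⟯) (w : VField IF F) where
  toLinearMap : Cₛ^∞⟮IM; A₀, A⟯ →ₗ[ℝ] Cₛ^∞⟮IF; A₀, (φ *ᵖ A)⟯
  leibniz : ∀ (f : C^∞⟮IM, M; ℝ⟯) X, toLinearMap (f • X) =
    f.comp φ • toLinearMap X + deriv w (f.comp φ) • pullbackSection φ X

namespace DerivationAlong

variable {φ : C^∞⟮IF, F; IM, M⟯} {w : VField IF F} (δ : DerivationAlong A₀ A φ w)

/-- The extension of a derivation to sections of the pullback bundle, by the formula that is valid
where the cutoff function of the local generators is equal to `1`. -/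
def localExtension {m : M} (G : LocalGenerators IM A₀ A m) :
    Cₛ^∞⟮IF; A₀, (φ *ᵖ A)⟯ →ₗ[ℝ] Cₛ^∞⟮IF; A₀, (φ *ᵖ A)⟯ where
  toFun s := ∑ i, (G.coefPullback i s • δ.toLinearMap (G.sec i) +
    deriv w (G.coefPullback i s) • pullbackSection φ (G.sec i))
  map_add' s t := by
    rw [← Finset.sum_add_distrib]
    refine Finset.sum_congr rfl fun i _ => ?_
    rw [G.coefPullback_add, deriv_fun_add]
    module
  map_smul' r s := by
    rw [RingHom.id_apply, Finset.smul_sum]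
    refine Finset.sum_congr rfl fun i _ => ?_
    rw [G.coefPullback_const_smul, deriv_fun_const_smul, smul_add, smul_assoc, smul_assoc]

theorem localExtension_apply {m : M} (G : LocalGenerators IM A₀ A m)
    (s : Cₛ^∞⟮IF; A₀, (φ *ᵖ A)⟯) : δ.localExtension G s =
      ∑ i, (G.coefPullback i s • δ.toLinearMap (G.sec i) +
        deriv w (G.coefPullback i s) • pullbackSection φ (G.sec i)) := rfl

/-- This is the Leibniz rule up to the cutoff, which enters because the generators reproduce `cutoff
• s` rather than `s`. -/
theorem localExtension_fsmul {m : M} (G : LocalGenerators IM A₀ A m) (h : C^∞⟮IF, F; ℝ⟯)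
    (s : Cₛ^∞⟮IF; A₀, (φ *ᵖ A)⟯) : δ.localExtension G (h • s) =
      h • δ.localExtension G s + deriv w h • G.cutoff.comp φ • s := by
  rw [← G.sum_coefPullback_smul]
  simp only [localExtension_apply, Finset.smul_sum]
  rw [← Finset.sum_add_distrib]
  refine Finset.sum_congr rfl fun i _ => ?_
  rw [G.coefPullback_fsmul, deriv_fun_mul]
  module

/-- On a pullback the coefficients come from `M`, so the Leibniz rule of `δ` applies term by term
and the sum is `δ (cutoff • X)`. -/
theorem localExtension_pullbackSection {m : M} (G : LocalGenerators IM A₀ A m)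
    (X : Cₛ^∞⟮IM; A₀, A⟯) : δ.localExtension G (pullbackSection φ X) =
      G.cutoff.comp φ • δ.toLinearMap X +
        deriv w (G.cutoff.comp φ) • pullbackSection φ X := by
  rw [← δ.leibniz, ← G.sum_coefSection_smul, map_sum, localExtension_apply]
  exact Finset.sum_congr rfl fun i _ => (δ.leibniz (G.coefSection i X) (G.sec i)).symm

/-- Both sides compute the extension by `G` of `s` multiplied by the cutoff of `G'`: the left by the
Leibniz rule, the right by expanding this product in the generators of `G'`. Where both cutoffs are
locally `1`, the two extensions therefore agree. -/
theorem localExtension_compare {m m' : M} (G : LocalGenerators IM A₀ A m)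
    (G' : LocalGenerators IM A₀ A m') (s : Cₛ^∞⟮IF; A₀, (φ *ᵖ A)⟯) :
    G'.cutoff.comp φ • δ.localExtension G s +
        deriv w (G'.cutoff.comp φ) • G.cutoff.comp φ • s =
      G.cutoff.comp φ • δ.localExtension G' s +
        deriv w (G.cutoff.comp φ) • G'.cutoff.comp φ • s := by
  rw [← δ.localExtension_fsmul, ← G'.sum_coefPullback_smul, map_sum]
  simp only [localExtension_fsmul, localExtension_pullbackSection]
  simp only [localExtension_apply, Finset.smul_sum]
  rw [← Finset.sum_add_distrib]
  refine Finset.sum_congr rfl fun i _ => ?_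
  module

theorem localExtension_apply_eq {m m' : M} (G : LocalGenerators IM A₀ A m)
    (G' : LocalGenerators IM A₀ A m') (s : Cₛ^∞⟮IF; A₀, (φ *ᵖ A)⟯) {q : F}
    (h : ∀ᶠ x in 𝓝 (φ q), G.cutoff x = 1) (h' : ∀ᶠ x in 𝓝 (φ q), G'.cutoff x = 1) :
    δ.localExtension G s q = δ.localExtension G' s q := by
  have hφ : ContinuousAt φ q := φ.contMDiff.continuous.continuousAt
  have e := congrArg (fun t : Cₛ^∞⟮IF; A₀, (φ *ᵖ A)⟯ => t q) (δ.localExtension_compare G G' s)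
  have h1 : (G.cutoff.comp φ) q = 1 := h.self_of_nhds
  have h1' : (G'.cutoff.comp φ) q = 1 := h'.self_of_nhds
  have h2 : deriv w (G.cutoff.comp φ) q = 0 :=
    deriv_eq_zero_of_eventually_eq w (r := 1) (hφ.eventually h)
  have h2' : deriv w (G'.cutoff.comp φ) q = 0 :=
    deriv_eq_zero_of_eventually_eq w (r := 1) (hφ.eventually h')
  simpa [h1, h1', h2, h2'] using e

variable [FiniteDimensional ℝ EM] [IsManifold IM ∞ M] [T2Space M]
    [FiniteDimensional ℝ A₀] [ContMDiffVectorBundle ∞ A₀ A IM]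

theorem contMDiff_extension (s : Cₛ^∞⟮IF; A₀, (φ *ᵖ A)⟯) :
    ContMDiff IF (IF.prod 𝓘(ℝ, A₀)) ∞ fun p =>
      (⟨p, δ.localExtension (localGenerators IM A₀ A (φ p)) s p⟩ :
        TotalSpace A₀ (φ *ᵖ A)) := by
  intro p
  let G := localGenerators IM A₀ A (φ p)
  refine ((δ.localExtension G s).contMDiff p).congr_of_eventuallyEq ?_
  have hφ : ContinuousAt φ p := φ.contMDiff.continuous.continuousAt
  -- The cutoff of `G` has to be `1` near `φ q`, not only at it, so that its derivative vanishes at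
  -- `q` too.
  filter_upwards [hφ.eventually G.cutoff_eq_one.eventually_nhds] with q hq
  rw [δ.localExtension_apply_eq _ G s (localGenerators IM A₀ A (φ q)).cutoff_eq_one hq]

variable [CompleteSpace EF]

/-- The derivative endomorphism of the pullback bundle that extends `δ`. -/
def extension : DerEnd IF A₀ (φ *ᵖ A) :=
  ⟨({ toFun := fun s => ⟨fun p => δ.localExtension (localGenerators IM A₀ A (φ p)) s p,
        δ.contMDiff_extension s⟩
      map_add' := fun s t => by
        ext p
        exact congrArg (evalAt IF A₀ (φ *ᵖ A) p) (map_add (δ.localExtension _) s t)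
      map_smul' := fun r s => by
        ext p
        exact congrArg (evalAt IF A₀ (φ *ᵖ A) p) (map_smul (δ.localExtension _) r s) }, w), by
    intro f s
    ext p
    let G := localGenerators IM A₀ A (φ p)
    have h1 : (G.cutoff.comp φ) p = 1 := G.cutoff_self
    have e := congrArg (evalAt IF A₀ (φ *ᵖ A) p) (δ.localExtension_fsmul G f s)
    refine e.trans ?_
    show f p • δ.localExtension G s p + deriv w f p • (G.cutoff.comp φ) p • s p = _
    rw [h1, one_smul]
    rfl⟩

theorem op_extension_pullbackSection (X : Cₛ^∞⟮IM; A₀, A⟯) :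
    DerEnd.op δ.extension (pullbackSection φ X) = δ.toLinearMap X := by
  ext p
  let G := localGenerators IM A₀ A (φ p)
  have hφ : ContinuousAt φ p := φ.contMDiff.continuous.continuousAt
  have h1 : (G.cutoff.comp φ) p = 1 := G.cutoff_self
  have h2 : deriv w (G.cutoff.comp φ) p = 0 :=
    deriv_eq_zero_of_eventually_eq w (r := 1) (hφ.eventually G.cutoff_eq_one)
  have e := congrArg (evalAt IF A₀ (φ *ᵖ A) p) (δ.localExtension_pullbackSection G X)
  refine e.trans ?_
  show (G.cutoff.comp φ) p • δ.toLinearMap X p +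
    deriv w (G.cutoff.comp φ) p • pullbackSection φ X p = _
  rw [h1, h2, one_smul, zero_smul, add_zero]

end DerivationAlong

variable [FiniteDimensional ℝ EM] [IsManifold IM ∞ M] [T2Space M]
    [FiniteDimensional ℝ A₀] [ContMDiffVectorBundle ∞ A₀ A IM] [CompleteSpace EF]
    {φ : C^∞⟮IF, F; IM, M⟯}

/-- Derivative endomorphisms of the pullback bundle are determined by their symbol and their values
on pullbacks of sections. -/
theorem DerEnd.eq_of_pullbackSection {D D' : DerEnd IF A₀ (φ *ᵖ A)}
    (hs : DerEnd.symbol D = DerEnd.symbol D')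
    (h : ∀ X : Cₛ^∞⟮IM; A₀, A⟯,
      DerEnd.op D (pullbackSection φ X) = DerEnd.op D' (pullbackSection φ X)) : D = D' := by
  refine DerEnd.ext (fun s => ?_) hs
  ext p
  rw [← sub_eq_zero]
  refine eq_zero_of_pullbackSection (p := p)
    (evalAt IF A₀ (φ *ᵖ A) p ∘ₗ (DerEnd.op D - DerEnd.op D')) (fun f t => ?_) (fun X => ?_) s
  · simp only [LinearMap.comp_apply, LinearMap.sub_apply, DerEnd.op_fsmul, hs, add_sub_add_right_eq_sub,
      ← smul_sub]
    rfl
  · simp [h X]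

end Extension

/-! ### Skew symmetry and Leibniz rules in a Lie algebroid -/

section LieAlgebroidLemmas

variable {EM : Type*} [NormedAddCommGroup EM] [NormedSpace ℝ EM]
  {HM : Type*} [TopologicalSpace HM] {I : ModelWithCorners ℝ EM HM}
  {M : Type*} [TopologicalSpace M] [ChartedSpace HM M] [IsManifold I ∞ M]
  {A₀ : Type*} [NormedAddCommGroup A₀] [NormedSpace ℝ A₀]
  {A : M → Type*} [TopologicalSpace (TotalSpace A₀ A)] [∀ x, TopologicalSpace (A x)]
  [FiberBundle A₀ A] [∀ x, AddCommGroup (A x)] [∀ x, Module ℝ (A x)] [VectorBundle ℝ A₀ A]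

namespace LieAlgebroid

variable (L : LieAlgebroid I A₀ A)

theorem bracket_skew (X Y : Cₛ^∞⟮I; A₀, A⟯) : L.bracket X Y = -L.bracket Y X := by
  have h := L.bracket_self (X + Y)
  simp only [map_add, LinearMap.add_apply, L.bracket_self, zero_add, add_zero] at h
  rw [eq_neg_iff_add_eq_zero, add_comm]
  exact h

theorem bracket_fsmul_right (X : Cₛ^∞⟮I; A₀, A⟯) (f : C^∞⟮I, M; ℝ⟯) (Y : Cₛ^∞⟮I; A₀, A⟯) :
    L.bracket X (f • Y) = f • L.bracket X Y + deriv (L.anchorSection X) f • Y := by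
  ext x
  exact L.leibniz X f Y x

theorem bracket_fsmul_left (f : C^∞⟮I, M; ℝ⟯) (X Y : Cₛ^∞⟮I; A₀, A⟯) :
    L.bracket (f • X) Y = f • L.bracket X Y - deriv (L.anchorSection Y) f • X := by
  rw [L.bracket_skew, L.bracket_fsmul_right, L.bracket_skew Y X]
  module

end LieAlgebroid

end LieAlgebroidLemmas

/-! ### The action Lie algebroid -/

namespace InfinitesimalAction

variable {EM : Type*} [NormedAddCommGroup EM] [NormedSpace ℝ EM]
  {HM : Type*} [TopologicalSpace HM] {IM : ModelWithCorners ℝ EM HM}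
  {M : Type*} [TopologicalSpace M] [ChartedSpace HM M] [IsManifold IM ∞ M]
  {EF : Type*} [NormedAddCommGroup EF] [NormedSpace ℝ EF] [CompleteSpace EF]
  {HF : Type*} [TopologicalSpace HF] {IF : ModelWithCorners ℝ EF HF}
  {F : Type*} [TopologicalSpace F] [ChartedSpace HF F] [IsManifold IF ∞ F]
  {A₀ : Type*} [NormedAddCommGroup A₀] [NormedSpace ℝ A₀]
  {A : M → Type*} [TopologicalSpace (TotalSpace A₀ A)] [∀ x, TopologicalSpace (A x)]
  [FiberBundle A₀ A] [∀ x, AddCommGroup (A x)] [∀ x, Module ℝ (A x)] [VectorBundle ℝ A₀ A]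
  {LA : LieAlgebroid IM A₀ A} {φ : C^∞⟮IF, F; IM, M⟯} (act : InfinitesimalAction LA φ)

/-- Projectability of `X_F` combined with the chain rule. It turns the Leibniz rule of `A` into one
along `X_F`. -/
theorem deriv_comp (X : Cₛ^∞⟮IM; A₀, A⟯) (f : C^∞⟮IM, M; ℝ⟯) :
    deriv (act.toLinearMap X) (f.comp φ) = (deriv (LA.anchorSection X) f).comp φ := by
  ext p
  show mvfderiv IF (f ∘ φ) p (act.toLinearMap X p) =
    mvfderiv IM f (φ p) (LA.anchorSection X (φ p))
  rw [mvfderiv_comp_apply p (mdifferentiableAt_smoothMap f _)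
    (φ.contMDiff.contMDiffAt.mdifferentiableAt (by simp)), act.projectable]

/-- The derivation `Y ↦ [X, Y] ∘ φ` along `X_F`. -/
def adjointAlong (X : Cₛ^∞⟮IM; A₀, A⟯) : DerivationAlong A₀ A φ (act.toLinearMap X) where
  toLinearMap :=
    { toFun := fun Y => pullbackSection φ (LA.bracket X Y)
      map_add' := fun Y Z => by rw [map_add, pullbackSection_add]
      map_smul' := fun r Y => by rw [map_smul, pullbackSection_const_smul]; rfl }
  leibniz f Y := by
    show pullbackSection φ (LA.bracket X (f • Y)) = _
    rw [LA.bracket_fsmul_right, pullbackSection_add, pullbackSection_fsmul,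
      pullbackSection_fsmul, act.deriv_comp]
    rfl

variable [FiniteDimensional ℝ EM] [T2Space M]
    [FiniteDimensional ℝ A₀] [ContMDiffVectorBundle ∞ A₀ A IM]

/-- The anchor of the action Lie algebroid on fibres. -/
def anchorAt (p : F) : (φ *ᵖ A) p →ₗ[ℝ] TangentSpace IF p :=
  descend IM A₀ (m := φ p) (evalAt IF EF (TangentSpace IF) p ∘ₗ act.toLinearMap)

theorem anchorAt_apply (p : F) (X : Cₛ^∞⟮IM; A₀, A⟯) :
    act.anchorAt p (pullbackSection φ X p) = act.toLinearMap X p :=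
  descend_apply (evalAt IF EF (TangentSpace IF) p ∘ₗ act.toLinearMap)
    (fun f X => congrArg (evalAt IF EF (TangentSpace IF) p) (act.map_fsmul f X)) X

theorem contMDiff_anchorAt : ContMDiff (IF.prod 𝓘(ℝ, A₀)) IF.tangent ∞
    fun v : TotalSpace A₀ (φ *ᵖ A) => (⟨v.1, act.anchorAt v.1 v.2⟩ : TangentBundle IF F) :=
  contMDiff_of_pullbackSection (V₀ := EF) (V := (TangentSpace IF : F → Type _)) act.anchorAt
    fun X => by simpa only [anchorAt_apply] using (act.toLinearMap X).contMDiff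

/-- The anchor of the action Lie algebroid on sections. -/
def anchorField : Cₛ^∞⟮IF; A₀, (φ *ᵖ A)⟯ →ₗ[ℝ] VField IF F where
  toFun s := ⟨fun p => act.anchorAt p (s p), act.contMDiff_anchorAt.comp s.contMDiff⟩
  map_add' s t := by
    ext p
    exact map_add (act.anchorAt p) (s p) (t p)
  map_smul' r s := by
    ext p
    exact map_smul (act.anchorAt p) r (s p)

theorem anchorField_fsmul (h : C^∞⟮IF, F; ℝ⟯) (s : Cₛ^∞⟮IF; A₀, (φ *ᵖ A)⟯) :
    act.anchorField (h • s) = h • act.anchorField s := by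
  ext p
  exact map_smul (act.anchorAt p) (h p) (s p)

theorem anchorField_pullbackSection (X : Cₛ^∞⟮IM; A₀, A⟯) :
    act.anchorField (pullbackSection φ X) = act.toLinearMap X := by
  ext p
  exact act.anchorAt_apply p X

/-- The map `s ↦ a_F(s)(h) t` as a linear map on sections, at the point `p`. -/
def derivSmulAt (h : C^∞⟮IF, F; ℝ⟯) (t : Cₛ^∞⟮IF; A₀, (φ *ᵖ A)⟯) (p : F) :
    Cₛ^∞⟮IF; A₀, (φ *ᵖ A)⟯ →ₗ[ℝ] (φ *ᵖ A) p :=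
  ((mvfderiv IF h p : TangentSpace IF p →ₗ[ℝ] ℝ) ∘ₗ act.anchorAt p ∘ₗ
    evalAt IF A₀ (φ *ᵖ A) p).smulRight (t p)

/-- Two derivative endomorphisms `D` and `D'` of the pullback bundle satisfy
`D s = h D' s - a_F(s)(h) t` for all sections `s` if this holds for pullbacks of sections and the
symbols are compatible. -/
theorem op_eq_of_pullbackSection {D D' : DerEnd IF A₀ (φ *ᵖ A)} {h : C^∞⟮IF, F; ℝ⟯}
    {t : Cₛ^∞⟮IF; A₀, (φ *ᵖ A)⟯} (hs : DerEnd.symbol D = h • DerEnd.symbol D')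
    (hD : ∀ X : Cₛ^∞⟮IM; A₀, A⟯, DerEnd.op D (pullbackSection φ X) =
      h • DerEnd.op D' (pullbackSection φ X) - deriv (act.toLinearMap X) h • t)
    (s : Cₛ^∞⟮IF; A₀, (φ *ᵖ A)⟯) :
    DerEnd.op D s = h • DerEnd.op D' s - deriv (act.anchorField s) h • t := by
  ext p
  rw [← sub_eq_zero]
  -- The defect `D s - h D' s + a_F(s)(h) t` is tensorial in `s`: the symbol terms of `D` and `h D'`
  -- cancel, and the last summand is already `C^∞(F)`-linear.
  have key := eq_zero_of_pullbackSection (p := p)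
    (evalAt IF A₀ (φ *ᵖ A) p ∘ₗ (DerEnd.op D - DerEnd.op (h • D')) + act.derivSmulAt h t p)
    (fun f u => ?_) (fun X => ?_) s
  · refine Eq.trans ?_ key
    show DerEnd.op D s p - (h p • DerEnd.op D' s p - deriv (act.anchorField s) h p • t p) =
      DerEnd.op D s p - h p • DerEnd.op D' s p + deriv (act.anchorField s) h p • t p
    abel
  · show (DerEnd.op D (f • u) - h • DerEnd.op D' (f • u)
        + deriv (act.anchorField (f • u)) h • t) p =
      (f • (DerEnd.op D u - h • DerEnd.op D' u + deriv (act.anchorField u) h • t)) p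
    congr 1
    rw [DerEnd.op_fsmul, DerEnd.op_fsmul, hs, anchorField_fsmul, deriv_fsmul_field,
      deriv_fsmul_field]
    module
  · show (DerEnd.op D (pullbackSection φ X) - h • DerEnd.op D' (pullbackSection φ X)
        + deriv (act.anchorField (pullbackSection φ X)) h • t) p =
      (0 : Cₛ^∞⟮IF; A₀, (φ *ᵖ A)⟯) p
    congr 1
    rw [hD, anchorField_pullbackSection]
    abel

/-- The derivative endomorphism `h ⊗ Y ↦ h ⊗ [X, Y] + X_F(h) ⊗ Y` of the pullback bundle. -/
def adjoint (X : Cₛ^∞⟮IM; A₀, A⟯) : DerEnd IF A₀ (φ *ᵖ A) :=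
  (act.adjointAlong X).extension

theorem symbol_adjoint (X : Cₛ^∞⟮IM; A₀, A⟯) :
    DerEnd.symbol (act.adjoint X) = act.toLinearMap X := rfl

theorem op_adjoint_pullbackSection (X Y : Cₛ^∞⟮IM; A₀, A⟯) :
    DerEnd.op (act.adjoint X) (pullbackSection φ Y) = pullbackSection φ (LA.bracket X Y) :=
  (act.adjointAlong X).op_extension_pullbackSection Y

theorem adjoint_add (X Y : Cₛ^∞⟮IM; A₀, A⟯) :
    act.adjoint (X + Y) = act.adjoint X + act.adjoint Y := by
  refine DerEnd.eq_of_pullbackSection (map_add act.toLinearMap X Y) fun Z => ?_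
  rw [op_adjoint_pullbackSection, map_add]
  show _ = DerEnd.op (act.adjoint X) _ + DerEnd.op (act.adjoint Y) _
  rw [op_adjoint_pullbackSection, op_adjoint_pullbackSection]
  rfl

theorem adjoint_const_smul (r : ℝ) (X : Cₛ^∞⟮IM; A₀, A⟯) :
    act.adjoint (r • X) = r • act.adjoint X := by
  refine DerEnd.eq_of_pullbackSection (map_smul act.toLinearMap r X) fun Z => ?_
  rw [op_adjoint_pullbackSection, map_smul]
  show _ = r • DerEnd.op (act.adjoint X) _
  rw [op_adjoint_pullbackSection]
  rfl

/-- The correction to function linearity of `adjoint` is, up to sign, the Leibniz term along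
`a_F(s)`; this permits the second extension, in `bracketAlong`. -/
theorem op_adjoint_fsmul (f : C^∞⟮IM, M; ℝ⟯) (X : Cₛ^∞⟮IM; A₀, A⟯)
    (s : Cₛ^∞⟮IF; A₀, (φ *ᵖ A)⟯) :
    DerEnd.op (act.adjoint (f • X)) s = f.comp φ • DerEnd.op (act.adjoint X) s -
      deriv (act.anchorField s) (f.comp φ) • pullbackSection φ X := by
  refine act.op_eq_of_pullbackSection (D := act.adjoint (f • X)) (D' := act.adjoint X)
    (act.map_fsmul f X) (fun Y => ?_) s
  rw [op_adjoint_pullbackSection, op_adjoint_pullbackSection, LA.bracket_fsmul_left,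
    act.deriv_comp]
  rfl

/-- The derivation `X ↦ [s, X ∘ φ]` along `a_F(s)`. -/
def bracketAlong (s : Cₛ^∞⟮IF; A₀, (φ *ᵖ A)⟯) : DerivationAlong A₀ A φ (act.anchorField s) where
  toLinearMap :=
    { toFun := fun X => -DerEnd.op (act.adjoint X) s
      map_add' := fun X Y => by
        rw [adjoint_add, ← neg_add]
        rfl
      map_smul' := fun r X => by
        rw [adjoint_const_smul, RingHom.id_apply, smul_neg]
        rfl }
  leibniz f X := by
    show -DerEnd.op (act.adjoint (f • X)) s = f.comp φ • -DerEnd.op (act.adjoint X) s + _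
    rw [op_adjoint_fsmul]
    module

/-- The derivative endomorphism `[s, ·]` of the pullback bundle. -/
def bracketDer (s : Cₛ^∞⟮IF; A₀, (φ *ᵖ A)⟯) : DerEnd IF A₀ (φ *ᵖ A) :=
  (act.bracketAlong s).extension

theorem op_bracketDer_pullbackSection (s : Cₛ^∞⟮IF; A₀, (φ *ᵖ A)⟯) (X : Cₛ^∞⟮IM; A₀, A⟯) :
    DerEnd.op (act.bracketDer s) (pullbackSection φ X) = -DerEnd.op (act.adjoint X) s :=
  (act.bracketAlong s).op_extension_pullbackSection X

/-- The two stages of the construction are consistent: the symbols agree, and on pullbacks the skew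
symmetry of the bracket of `A` identifies the values. -/
theorem bracketDer_pullbackSection (X : Cₛ^∞⟮IM; A₀, A⟯) :
    act.bracketDer (pullbackSection φ X) = act.adjoint X := by
  refine DerEnd.eq_of_pullbackSection (act.anchorField_pullbackSection X) fun Y => ?_
  rw [op_bracketDer_pullbackSection, op_adjoint_pullbackSection, op_adjoint_pullbackSection,
    LA.bracket_skew X Y]
  rfl

theorem bracketDer_add (s t : Cₛ^∞⟮IF; A₀, (φ *ᵖ A)⟯) :
    act.bracketDer (s + t) = act.bracketDer s + act.bracketDer t := by
  refine DerEnd.eq_of_pullbackSection (map_add act.anchorField s t) fun X => ?_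
  rw [op_bracketDer_pullbackSection, map_add, neg_add, ← op_bracketDer_pullbackSection,
    ← op_bracketDer_pullbackSection]
  rfl

theorem bracketDer_const_smul (r : ℝ) (s : Cₛ^∞⟮IF; A₀, (φ *ᵖ A)⟯) :
    act.bracketDer (r • s) = r • act.bracketDer s := by
  refine DerEnd.eq_of_pullbackSection (map_smul act.anchorField r s) fun X => ?_
  rw [op_bracketDer_pullbackSection, map_smul, ← smul_neg, ← op_bracketDer_pullbackSection]
  rfl

/-- The bracket of the action Lie algebroid. -/
def bracket : Cₛ^∞⟮IF; A₀, (φ *ᵖ A)⟯ →ₗ[ℝ] Cₛ^∞⟮IF; A₀, (φ *ᵖ A)⟯ →ₗ[ℝ]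
    Cₛ^∞⟮IF; A₀, (φ *ᵖ A)⟯ where
  toFun s := DerEnd.op (act.bracketDer s)
  map_add' s t := by rw [bracketDer_add]; rfl
  map_smul' r s := by rw [bracketDer_const_smul]; rfl

theorem bracket_fsmul_right (s : Cₛ^∞⟮IF; A₀, (φ *ᵖ A)⟯) (h : C^∞⟮IF, F; ℝ⟯)
    (t : Cₛ^∞⟮IF; A₀, (φ *ᵖ A)⟯) :
    act.bracket s (h • t) = h • act.bracket s t + deriv (act.anchorField s) h • t :=
  DerEnd.op_fsmul (act.bracketDer s) h t

/-- Skew symmetry is not yet available and will rest on this rule. For `t` a pullback `X ∘ φ`, the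
rule is the Leibniz rule of `adjoint X`. -/
theorem bracket_fsmul_left (h : C^∞⟮IF, F; ℝ⟯) (s t : Cₛ^∞⟮IF; A₀, (φ *ᵖ A)⟯) :
    act.bracket (h • s) t = h • act.bracket s t - deriv (act.anchorField t) h • s := by
  refine act.op_eq_of_pullbackSection (D := act.bracketDer (h • s)) (D' := act.bracketDer s)
    (act.anchorField_fsmul h s) (fun X => ?_) t
  rw [op_bracketDer_pullbackSection, op_bracketDer_pullbackSection, DerEnd.op_fsmul,
    symbol_adjoint]
  module

theorem bracket_pullbackSection (X Y : Cₛ^∞⟮IM; A₀, A⟯) :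
    act.bracket (pullbackSection φ X) (pullbackSection φ Y) =
      pullbackSection φ (LA.bracket X Y) := by
  show DerEnd.op (act.bracketDer (pullbackSection φ X)) _ = _
  rw [bracketDer_pullbackSection, op_adjoint_pullbackSection]

theorem bracket_skew (s t : Cₛ^∞⟮IF; A₀, (φ *ᵖ A)⟯) :
    act.bracket s t = -act.bracket t s := by
  rw [eq_neg_iff_add_eq_zero]
  ext p
  refine eq_zero_of_pullbackSection (p := p)
    (evalAt IF A₀ (φ *ᵖ A) p ∘ₗ (act.bracket s + act.bracket.flip s)) (fun h u => ?_)
    (fun X => ?_) t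
  · show (act.bracket s (h • u) + act.bracket (h • u) s) p =
      (h • (act.bracket s u + act.bracket u s)) p
    congr 1
    rw [bracket_fsmul_right, bracket_fsmul_left]
    module
  · show (act.bracket s (pullbackSection φ X) + act.bracket (pullbackSection φ X) s) p =
      (0 : Cₛ^∞⟮IF; A₀, (φ *ᵖ A)⟯) p
    congr 1
    show DerEnd.op (act.bracketDer s) _ + DerEnd.op (act.bracketDer (pullbackSection φ X)) _ = 0
    rw [op_bracketDer_pullbackSection, bracketDer_pullbackSection, neg_add_cancel]

theorem bracket_self (s : Cₛ^∞⟮IF; A₀, (φ *ᵖ A)⟯) : act.bracket s s = 0 := by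
  have h := act.bracket_skew s s
  rw [eq_neg_iff_add_eq_zero, ← two_smul ℝ] at h
  exact (smul_eq_zero.1 h).resolve_left two_ne_zero

/-- It precedes the Jacobi identity because it supplies the equality of symbols in
`jacobi_of_pullbackSection`. -/
theorem anchorField_bracket (s t : Cₛ^∞⟮IF; A₀, (φ *ᵖ A)⟯) :
    act.anchorField (act.bracket s t) = ⁅act.anchorField s, act.anchorField t⁆ := by
  rw [← sub_eq_zero]
  ext p
  -- The defect, as a bilinear map with values in global vector fields; `LieModule.toEnd` provides
  -- the Lie bracket in bilinear form.
  let β : Cₛ^∞⟮IF; A₀, (φ *ᵖ A)⟯ →ₗ[ℝ] Cₛ^∞⟮IF; A₀, (φ *ᵖ A)⟯ →ₗ[ℝ] VField IF F :=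
    act.bracket.compr₂ act.anchorField -
      ((LieModule.toEnd ℝ (VField IF F) (VField IF F) : VField IF F →ₗ[ℝ] _).compl₁₂
        act.anchorField act.anchorField)
  have hβ : ∀ s t, β s t = act.anchorField (act.bracket s t) -
      ⁅act.anchorField s, act.anchorField t⁆ := fun s t => rfl
  refine bilin_eq_zero_of_pullbackSection (p := p) (β.compr₂ (evalAt IF EF (TangentSpace IF) p))
    (fun u v => ?_) (fun u h v => ?_) (fun X Y => ?_) s t
  · show (β u v) p = (-(β v u)) p
    congr 1
    rw [hβ, hβ, act.bracket_skew, map_neg, ← lie_skew]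
    abel
  · show (β u (h • v)) p = (h • β u v) p
    congr 1
    rw [hβ, hβ, bracket_fsmul_right, map_add, anchorField_fsmul, anchorField_fsmul,
      anchorField_fsmul, lie_fsmul_eq]
    module
  · show (β (pullbackSection φ X) (pullbackSection φ Y)) p = (0 : VField IF F) p
    congr 1
    rw [hβ, bracket_pullbackSection, anchorField_pullbackSection, anchorField_pullbackSection,
      anchorField_pullbackSection, act.map_bracket, sub_self]

/-- The Jacobi identity for `s`, `t`, `u` follows from the case where `u` is the pullback of a
section. -/
theorem jacobi_of_pullbackSection {s t : Cₛ^∞⟮IF; A₀, (φ *ᵖ A)⟯}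
    (h : ∀ X : Cₛ^∞⟮IM; A₀, A⟯, act.bracket s (act.bracket t (pullbackSection φ X)) +
      act.bracket t (act.bracket (pullbackSection φ X) s) +
      act.bracket (pullbackSection φ X) (act.bracket s t) = 0) (u : Cₛ^∞⟮IF; A₀, (φ *ᵖ A)⟯) :
    act.bracket s (act.bracket t u) + act.bracket t (act.bracket u s) +
      act.bracket u (act.bracket s t) = 0 := by
  have hJ : ∀ u, act.bracket s (act.bracket t u) + act.bracket t (act.bracket u s) +
      act.bracket u (act.bracket s t) =
      DerEnd.op ⁅act.bracketDer s, act.bracketDer t⁆ u -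
        -- By skew symmetry, the Jacobi sum measures whether `s ↦ [s, ·]` preserves brackets.
        DerEnd.op (act.bracketDer (act.bracket s t)) u := fun u => by
    rw [act.bracket_skew u s, act.bracket_skew u (act.bracket s t), map_neg, DerEnd.op_lie,
      sub_eq_add_neg, sub_eq_add_neg]
    rfl
  have hD : ⁅act.bracketDer s, act.bracketDer t⁆ = act.bracketDer (act.bracket s t) := by
    refine DerEnd.eq_of_pullbackSection (act.anchorField_bracket s t).symm fun X => ?_
    rw [← sub_eq_zero, ← hJ, h]
  rw [hJ, hD, sub_self]

theorem jacobi (s t u : Cₛ^∞⟮IF; A₀, (φ *ᵖ A)⟯) :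
    act.bracket s (act.bracket t u) + act.bracket t (act.bracket u s) +
      act.bracket u (act.bracket s t) = 0 := by
  refine act.jacobi_of_pullbackSection (fun X => ?_) u
  -- The Jacobi sum is cyclic: rotating it brings the next general section into the last place,
  -- until all three are pullbacks.
  rw [add_comm, ← add_assoc]
  refine act.jacobi_of_pullbackSection (fun Y => ?_) t
  rw [add_comm, ← add_assoc]
  refine act.jacobi_of_pullbackSection (fun Z => ?_) s
  simp only [bracket_pullbackSection, ← pullbackSection_add, LA.jacobi]
  rfl

/-- The action Lie algebroid. -/
def actionLieAlgebroid : LieAlgebroid IF A₀ (φ *ᵖ A) where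
  anchor := act.anchorAt
  contMDiff_anchor := act.contMDiff_anchorAt
  bracket := act.bracket
  bracket_self := act.bracket_self
  jacobi := act.jacobi
  anchor_bracket s t x :=
    congrArg (fun V : VField IF F => V x) (act.anchorField_bracket s t)
  leibniz s f t x :=
    congrArg (fun V : Cₛ^∞⟮IF; A₀, (φ *ᵖ A)⟯ => V x) (act.bracket_fsmul_right s f t)

theorem isActionLieAlgebroid_actionLieAlgebroid :
    IsActionLieAlgebroid act act.actionLieAlgebroid where
  anchor_eq h X := by
    show act.anchorField (h • pullbackSection φ X) = _
    rw [anchorField_fsmul, anchorField_pullbackSection]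
  bracket_eq h k X Y := by
    show act.bracket (h • pullbackSection φ X) (k • pullbackSection φ Y) = _
    rw [bracket_fsmul_right, bracket_fsmul_left, bracket_pullbackSection, anchorField_fsmul,
      anchorField_pullbackSection, anchorField_pullbackSection, deriv_fsmul_field]
    module

end InfinitesimalAction

/-! ### Uniqueness of the action Lie algebroid -/

namespace IsActionLieAlgebroid

variable {EM : Type*} [NormedAddCommGroup EM] [NormedSpace ℝ EM]
  {HM : Type*} [TopologicalSpace HM] {IM : ModelWithCorners ℝ EM HM}
  {M : Type*} [TopologicalSpace M] [ChartedSpace HM M] [IsManifold IM ∞ M]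
  {EF : Type*} [NormedAddCommGroup EF] [NormedSpace ℝ EF] [CompleteSpace EF]
  {HF : Type*} [TopologicalSpace HF] {IF : ModelWithCorners ℝ EF HF}
  {F : Type*} [TopologicalSpace F] [ChartedSpace HF F] [IsManifold IF ∞ F]
  {A₀ : Type*} [NormedAddCommGroup A₀] [NormedSpace ℝ A₀]
  {A : M → Type*} [TopologicalSpace (TotalSpace A₀ A)] [∀ x, TopologicalSpace (A x)]
  [FiberBundle A₀ A] [∀ x, AddCommGroup (A x)] [∀ x, Module ℝ (A x)] [VectorBundle ℝ A₀ A]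
  {LA : LieAlgebroid IM A₀ A} {φ : C^∞⟮IF, F; IM, M⟯} {act : InfinitesimalAction LA φ}
  {L L' : LieAlgebroid IF A₀ (φ *ᵖ A)}

theorem anchorSection_pullbackSection (hL : IsActionLieAlgebroid act L)
    (X : Cₛ^∞⟮IM; A₀, A⟯) : L.anchorSection (pullbackSection φ X) = act.toLinearMap X := by
  simpa only [one_smul] using hL.anchor_eq 1 X

theorem bracket_pullbackSection (hL : IsActionLieAlgebroid act L) (X Y : Cₛ^∞⟮IM; A₀, A⟯) :
    L.bracket (pullbackSection φ X) (pullbackSection φ Y) =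
      pullbackSection φ (LA.bracket X Y) := by
  simpa only [one_smul, deriv_one, mul_zero, zero_smul, mul_one, add_zero, sub_zero]
    using hL.bracket_eq 1 1 X Y

variable [FiniteDimensional ℝ EM] [T2Space M]
    [FiniteDimensional ℝ A₀] [ContMDiffVectorBundle ∞ A₀ A IM]

/-- Anchors agree because every vector of `φ^* A` is the value of a pullback. The difference of the
brackets is then tensorial, as the Leibniz terms cancel, and it is zero on pullbacks. -/
theorem unique (hL : IsActionLieAlgebroid act L) (hL' : IsActionLieAlgebroid act L') :
    L = L' := by
  have ha : L.anchor = L'.anchor := by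
    funext p
    refine LinearMap.ext fun v => ?_
    obtain ⟨X, rfl⟩ := exists_section_apply_eq IM A₀ (m := φ p) v
    exact congrArg (fun V : VField IF F => V p) ((hL.anchorSection_pullbackSection X).trans
      (hL'.anchorSection_pullbackSection X).symm)
  have hb : L.bracket = L'.bracket := by
    refine LinearMap.ext fun s => LinearMap.ext fun t => ?_
    ext p
    rw [← sub_eq_zero]
    refine bilin_eq_zero_of_pullbackSection (p := p)
      ((L.bracket - L'.bracket).compr₂ (evalAt IF A₀ (φ *ᵖ A) p))
      (fun u v => ?_) (fun u h v => ?_) (fun X Y => ?_) s t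
    · show (L.bracket u v - L'.bracket u v) p = (-(L.bracket v u - L'.bracket v u)) p
      congr 1
      rw [L.bracket_skew, L'.bracket_skew]
      abel
    · show (L.bracket u (h • v) - L'.bracket u (h • v)) p =
        (h • (L.bracket u v - L'.bracket u v)) p
      have : L.anchorSection u = L'.anchorSection u := by
        ext q
        exact congrArg (fun a => a q (u q)) ha
      congr 1
      rw [L.bracket_fsmul_right, L'.bracket_fsmul_right, this]
      module
    · show (L.bracket (pullbackSection φ X) (pullbackSection φ Y) -
        L'.bracket (pullbackSection φ X) (pullbackSection φ Y)) p =
        (0 : Cₛ^∞⟮IF; A₀, (φ *ᵖ A)⟯) p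
      congr 1
      rw [hL.bracket_pullbackSection, hL'.bracket_pullbackSection, sub_self]
  cases L
  cases L'
  congr

end IsActionLieAlgebroid

/-! ### Derivative representations and representations of the action Lie algebroid -/

section Representations

variable {EM : Type*} [NormedAddCommGroup EM] [NormedSpace ℝ EM]
  {HM : Type*} [TopologicalSpace HM] {IM : ModelWithCorners ℝ EM HM}
  {M : Type*} [TopologicalSpace M] [ChartedSpace HM M] [IsManifold IM ∞ M]
  {EF : Type*} [NormedAddCommGroup EF] [NormedSpace ℝ EF] [CompleteSpace EF]
  {HF : Type*} [TopologicalSpace HF] {IF : ModelWithCorners ℝ EF HF}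
  {F : Type*} [TopologicalSpace F] [ChartedSpace HF F] [IsManifold IF ∞ F]
  {A₀ : Type*} [NormedAddCommGroup A₀] [NormedSpace ℝ A₀]
  {A : M → Type*} [TopologicalSpace (TotalSpace A₀ A)] [∀ x, TopologicalSpace (A x)]
  [FiberBundle A₀ A] [∀ x, AddCommGroup (A x)] [∀ x, Module ℝ (A x)] [VectorBundle ℝ A₀ A]
  {E₀ : Type*} [NormedAddCommGroup E₀] [NormedSpace ℝ E₀]
  {E : F → Type*} [TopologicalSpace (TotalSpace E₀ E)] [∀ x, TopologicalSpace (E x)]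
  [FiberBundle E₀ E] [∀ x, AddCommGroup (E x)] [∀ x, Module ℝ (E x)] [VectorBundle ℝ E₀ E]
  {LA : LieAlgebroid IM A₀ A} {φ : C^∞⟮IF, F; IM, M⟯} {act : InfinitesimalAction LA φ}
  {L : LieAlgebroid IF A₀ (φ *ᵖ A)}

theorem DerivativeRep.ext_toLinearMap {ρ ρ' : DerivativeRep E₀ E act}
    (h : ∀ X p, DerEnd.eval (ρ.toLinearMap X) p = DerEnd.eval (ρ'.toLinearMap X) p) : ρ = ρ' := by
  have : ρ.toLinearMap = ρ'.toLinearMap :=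
    LinearMap.ext fun X => DerEnd.eval_injective fun p => h X p
  cases ρ
  cases ρ'
  congr

/-- The map induced on sections by a bundle map into `𝔇(E)`, as a linear map. -/
def BundleMap.onSectionsₗ (σ : BundleMap IF A₀ (φ *ᵖ A) E₀ E) :
    Cₛ^∞⟮IF; A₀, (φ *ᵖ A)⟯ →ₗ[ℝ] DerEnd IF E₀ E where
  toFun := σ.onSections
  map_add' s t := DerEnd.eval_injective fun p => map_add (σ.toFun p) (s p) (t p)
  map_smul' r s := DerEnd.eval_injective fun p => map_smul (σ.toFun p) r (s p)

theorem BundleMap.onSections_fsmul (σ : BundleMap IF A₀ (φ *ᵖ A) E₀ E) (h : C^∞⟮IF, F; ℝ⟯)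
    (s : Cₛ^∞⟮IF; A₀, (φ *ᵖ A)⟯) : σ.onSections (h • s) = h • σ.onSections s :=
  DerEnd.eval_injective fun p => map_smul (σ.toFun p) (h p) (s p)

theorem Representation.symbol_onSections (σ : Representation E₀ E L)
    (s : Cₛ^∞⟮IF; A₀, (φ *ᵖ A)⟯) :
    DerEnd.symbol (σ.onSections s) = L.anchorSection s := by
  ext p
  exact σ.anchor_comp p (s p)

/-- The derivative representation `X ↦ σ (X ∘ φ)`. -/
def Representation.toDerivativeRep (hL : IsActionLieAlgebroid act L) (σ : Representation E₀ E L) :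
    DerivativeRep E₀ E act where
  toLinearMap :=
    { toFun := fun X => σ.onSections (pullbackSection φ X)
      map_add' := fun X Y =>
        map_add σ.onSectionsₗ (pullbackSection φ X) (pullbackSection φ Y)
      map_smul' := fun r X => map_smul σ.onSectionsₗ r (pullbackSection φ X) }
  map_bracket X Y := by
    show σ.onSections (pullbackSection φ (LA.bracket X Y)) = _
    rw [← hL.bracket_pullbackSection, σ.map_bracket]
    rfl
  symbol_eq X := by
    show DerEnd.symbol (σ.onSections (pullbackSection φ X)) = _
    rw [σ.symbol_onSections, hL.anchorSection_pullbackSection]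
  map_fsmul f X := σ.onSections_fsmul (f.comp φ) (pullbackSection φ X)

variable [FiniteDimensional ℝ EM] [T2Space M]
    [FiniteDimensional ℝ A₀] [ContMDiffVectorBundle ∞ A₀ A IM]

theorem Representation.ext_pullbackSection {σ σ' : Representation E₀ E L}
    (h : ∀ (X : Cₛ^∞⟮IM; A₀, A⟯) p,
      σ.toFun p (pullbackSection φ X p) = σ'.toFun p (pullbackSection φ X p)) : σ = σ' := by
  have : σ.toFun = σ'.toFun := by
    funext p
    refine LinearMap.ext fun v => ?_
    obtain ⟨X, rfl⟩ := exists_section_apply_eq IM A₀ (m := φ p) v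
    exact h X p
  obtain ⟨⟨_, _⟩, _, _⟩ := σ
  obtain ⟨⟨_, _⟩, _, _⟩ := σ'
  congr

namespace DerivativeRep

variable (ρ : DerivativeRep E₀ E act)

/-- The bundle map `h ⊗ X ↦ h ρ(X)` on fibres. -/
def bundleMapAt (p : F) : (φ *ᵖ A) p →ₗ[ℝ] DFiber IF E₀ E p :=
  descend IM A₀ (m := φ p) (DerEnd.evalₗ p ∘ₗ ρ.toLinearMap)

theorem bundleMapAt_apply (p : F) (X : Cₛ^∞⟮IM; A₀, A⟯) :
    ρ.bundleMapAt p (pullbackSection φ X p) = DerEnd.eval (ρ.toLinearMap X) p :=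
  descend_apply (DerEnd.evalₗ p ∘ₗ ρ.toLinearMap)
    (fun f X => congrArg (DerEnd.evalₗ p) (ρ.map_fsmul f X)) X

/-- The bundle map `h ⊗ X ↦ h ρ(X)`. -/
def toBundleMap : BundleMap IF A₀ (φ *ᵖ A) E₀ E where
  toFun := ρ.bundleMapAt
  isSmooth := by
    refine ⟨?_, fun ψ => ?_⟩
    · refine contMDiff_of_pullbackSection (V₀ := EF) (V := (TangentSpace IF : F → Type _))
        (fun p => LinearMap.snd ℝ _ _ ∘ₗ (DFiber IF E₀ E p).subtype ∘ₗ ρ.bundleMapAt p)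
        fun X => ?_
      refine (DerEnd.symbol (ρ.toLinearMap X)).contMDiff.congr fun p => ?_
      exact congrArg (fun D => (⟨p, DFiber.anchor D⟩ : TangentBundle IF F))
        (ρ.bundleMapAt_apply p X)
    · refine contMDiff_of_pullbackSection
        (fun p => LinearMap.applyₗ ψ ∘ₗ LinearMap.fst ℝ _ _ ∘ₗ (DFiber IF E₀ E p).subtype ∘ₗ
          ρ.bundleMapAt p) fun X => ?_
      refine (DerEnd.op (ρ.toLinearMap X) ψ).contMDiff.congr fun p => ?_
      exact congrArg (fun D => (⟨p, DFiber.apply D ψ⟩ : TotalSpace E₀ E))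
        (ρ.bundleMapAt_apply p X)

theorem onSections_pullbackSection (X : Cₛ^∞⟮IM; A₀, A⟯) :
    ρ.toBundleMap.onSections (pullbackSection φ X) = ρ.toLinearMap X :=
  DerEnd.eval_injective fun p => ρ.bundleMapAt_apply p X

theorem anchor_bundleMapAt (hL : IsActionLieAlgebroid act L) (p : F) (v : (φ *ᵖ A) p) :
    DFiber.anchor (ρ.bundleMapAt p v) = L.anchor p v := by
  obtain ⟨X, rfl⟩ := exists_section_apply_eq IM A₀ (m := φ p) v
  refine (congrArg DFiber.anchor (ρ.bundleMapAt_apply p X)).trans ?_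
  refine (congrArg (fun V : VField IF F => V p) (ρ.symbol_eq X)).trans ?_
  exact congrArg (fun V : VField IF F => V p) (hL.anchorSection_pullbackSection X).symm

/-- The defect is tensorial because the symbol of the image of `s` is the anchor of `s`, so both
brackets have the same Leibniz term. -/
theorem onSections_bracket (hL : IsActionLieAlgebroid act L) (s t : Cₛ^∞⟮IF; A₀, (φ *ᵖ A)⟯) :
    ρ.toBundleMap.onSections (L.bracket s t) =
      ⁅ρ.toBundleMap.onSections s, ρ.toBundleMap.onSections t⁆ := by
  refine DerEnd.eval_injective fun p => ?_
  rw [← sub_eq_zero]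
  let σ := ρ.toBundleMap.onSectionsₗ
  let β : Cₛ^∞⟮IF; A₀, (φ *ᵖ A)⟯ →ₗ[ℝ] Cₛ^∞⟮IF; A₀, (φ *ᵖ A)⟯ →ₗ[ℝ] DerEnd IF E₀ E :=
    L.bracket.compr₂ σ -
      (LieModule.toEnd ℝ (DerEnd IF E₀ E) (DerEnd IF E₀ E) : DerEnd IF E₀ E →ₗ[ℝ] _).compl₁₂ σ σ
  have hβ : ∀ s t, β s t = σ (L.bracket s t) - ⁅σ s, σ t⁆ := fun s t => rfl
  have hσ : ∀ h s, σ (h • s) = h • σ s := ρ.toBundleMap.onSections_fsmul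
  have hs : ∀ s, DerEnd.symbol (σ s) = L.anchorSection s := fun s => by
    ext q
    exact ρ.anchor_bundleMapAt hL q (s q)
  refine bilin_eq_zero_of_pullbackSection (p := p) (β.compr₂ (DerEnd.evalₗ p))
    (fun u v => ?_) (fun u h v => ?_) (fun X Y => ?_) s t
  · show DerEnd.evalₗ p (β u v) = DerEnd.evalₗ p (-(β v u))
    congr 1
    rw [hβ, hβ, L.bracket_skew, map_neg, ← lie_skew]
    abel
  · show DerEnd.evalₗ p (β u (h • v)) = DerEnd.evalₗ p (h • β u v)
    congr 1
    rw [hβ, hβ, L.bracket_fsmul_right, map_add, hσ, hσ, hσ, DerEnd.lie_fsmul, hs]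
    module
  · show DerEnd.evalₗ p (β (pullbackSection φ X) (pullbackSection φ Y)) = DerEnd.evalₗ p 0
    congr 1
    have hX : ∀ X : Cₛ^∞⟮IM; A₀, A⟯, σ (pullbackSection φ X) = ρ.toLinearMap X :=
      ρ.onSections_pullbackSection
    rw [hβ, hL.bracket_pullbackSection, hX, hX, hX, ρ.map_bracket, sub_self]

/-- The representation `h ⊗ X ↦ h ρ(X)` of the action Lie algebroid. -/
def toRepresentation (hL : IsActionLieAlgebroid act L) : Representation E₀ E L where
  toBundleMap := ρ.toBundleMap
  anchor_comp := ρ.anchor_bundleMapAt hL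
  map_bracket := ρ.onSections_bracket hL

end DerivativeRep

variable (E₀ E) in
/-- Derivative representations of `A` are the same as representations of the action Lie
algebroid. -/
def derivativeRepEquiv (hL : IsActionLieAlgebroid act L) :
    DerivativeRep E₀ E act ≃ Representation E₀ E L where
  toFun ρ := ρ.toRepresentation hL
  invFun σ := σ.toDerivativeRep hL
  left_inv ρ := DerivativeRep.ext_toLinearMap fun X p => ρ.bundleMapAt_apply p X
  right_inv σ := Representation.ext_pullbackSection fun X p =>
    (σ.toDerivativeRep hL).bundleMapAt_apply p X

end Representations

end LieAlgd

end

theorem theorem3p2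
    {EM : Type*} [NormedAddCommGroup EM] [NormedSpace ℝ EM] [FiniteDimensional ℝ EM]
    {HM : Type*} [TopologicalSpace HM] {IM : ModelWithCorners ℝ EM HM} [IM.Boundaryless]
    {M : Type*} [TopologicalSpace M] [ChartedSpace HM M] [IsManifold IM ∞ M]
    [T2Space M] [SecondCountableTopology M]
    {EF : Type*} [NormedAddCommGroup EF] [NormedSpace ℝ EF] [FiniteDimensional ℝ EF]
    {HF : Type*} [TopologicalSpace HF] {IF : ModelWithCorners ℝ EF HF} [IF.Boundaryless]
    {F : Type*} [TopologicalSpace F] [ChartedSpace HF F] [IsManifold IF ∞ F]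
    [T2Space F] [SecondCountableTopology F]
    {A₀ : Type*} [NormedAddCommGroup A₀] [NormedSpace ℝ A₀] [FiniteDimensional ℝ A₀]
    {A : M → Type*} [TopologicalSpace (TotalSpace A₀ A)] [∀ x, TopologicalSpace (A x)]
    [FiberBundle A₀ A] [∀ x, AddCommGroup (A x)] [∀ x, Module ℝ (A x)] [VectorBundle ℝ A₀ A]
    [ContMDiffVectorBundle ∞ A₀ A IM]
    {E₀ : Type*} [NormedAddCommGroup E₀] [NormedSpace ℝ E₀] [FiniteDimensional ℝ E₀]
    {E : F → Type*} [TopologicalSpace (TotalSpace E₀ E)] [∀ x, TopologicalSpace (E x)]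
    [FiberBundle E₀ E] [∀ x, AddCommGroup (E x)] [∀ x, Module ℝ (E x)] [VectorBundle ℝ E₀ E]
    [ContMDiffVectorBundle ∞ E₀ E IF]
    (LA : LieAlgd.LieAlgebroid IM A₀ A)
    (φ : C^∞⟮IF, F; IM, M⟯) (hsubm : IsSubmersion IF IM ∞ φ) (hsurj : Function.Surjective φ)
    (act : LieAlgd.InfinitesimalAction LA φ) :
    (∃! L : LieAlgd.LieAlgebroid IF A₀ (φ *ᵖ A), LieAlgd.IsActionLieAlgebroid act L) ∧
    ∀ L : LieAlgd.LieAlgebroid IF A₀ (φ *ᵖ A), LieAlgd.IsActionLieAlgebroid act L →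
      ∃ e : LieAlgd.DerivativeRep E₀ E act ≃ LieAlgd.Representation E₀ E L,
        (∀ (ρ : LieAlgd.DerivativeRep E₀ E act) (h : C^∞⟮IF, F; ℝ⟯) (X : Cₛ^∞⟮IM; A₀, A⟯) (p : F),
          (e ρ).toFun p ((h • LieAlgd.pullbackSection φ X) p) =
            h p • LieAlgd.DerEnd.eval (ρ.toLinearMap X) p) ∧
        (∀ (σ : LieAlgd.Representation E₀ E L) (X : Cₛ^∞⟮IM; A₀, A⟯) (p : F),
          LieAlgd.DerEnd.eval ((e.symm σ).toLinearMap X) p = σ.toFun p (LieAlgd.pullbackSection φ X p)) := by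
  have : CompleteSpace EF := FiniteDimensional.complete ℝ EF
  refine ⟨⟨act.actionLieAlgebroid, act.isActionLieAlgebroid_actionLieAlgebroid,
    fun L hL => hL.unique act.isActionLieAlgebroid_actionLieAlgebroid⟩, fun L hL =>
    ⟨LieAlgd.derivativeRepEquiv E₀ E hL, fun ρ h X p => ?_, fun σ X p => rfl⟩⟩
  -- Linearity on the fibre at `p` reduces the formula to `h = 1`.
  exact (map_smul (ρ.bundleMapAt p) (h p) (LieAlgd.pullbackSection φ X p)).trans
    (congrArg (h p • ·) (ρ.bundleMapAt_apply p X))
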